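/- Let $\Lambda'\subset\mathbb C$ be a lattice with invariants $g_2(\Lambda')=0$ and $g_3(\Lambda')=1$, and let $\wp$ be its Weierstrass function, so that $(\wp')^2=4\wp^3-1$. Let $F_3=\{[x:y:z]\in\mathbb{CP}^2 : x^3+y^3=z^3\}$ be the Fermat cubic (the projective closure of $x^3+y^3=1$), regarded as a Riemann surface. Then the map $\mathbb C/\Lambda'\to F_3$ given in affine coordinates by $$z\mapsto\left(\frac{1}{2\wp(z)}\bigl(1-3^{-1/2}\wp'(z)\bigr),\ \frac{1}{2\wp(z)}\bigl(1+3^{-1/2}\wp'(z)\bigr)\right)$$ is a biholomorphism; that is, there is a biholomorphic map $\Phi:\mathbb C/\Lambda'\to F_3$ such that, for every $z\notin\Lambda'$ with $\wp(z)\neq0$, $\Phi(z+\Lambda')$ is the point of $F_3$ with these affine coordinates. Moreover, for every pair of meromorphic functions $F,G$ on $\mathbb C$ with $F^3+G^3=1$ there is an entire function $\alpha$ such that, as meromorphic functions, $$F=\frac{1}{2\wp(\alpha)}\bigl(1-3^{-1/2}\wp'(\alpha)\bigr),\qquad G=\frac{1}{2\wp(\alpha)}\bigl(1+3^{-1/2}\wp'(\alpha)\bigr).$$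 -/

import Mathlib

open scoped Manifold ContDiff Topology LinearAlgebra.Projectivization

noncomputable section

/-! ### The complex torus `ℂ / Λ` as a Riemann surface

The topology of `ℂ ⧸ L.lattice` is Mathlib's quotient topology; the charts are the local inverses
of the projection `ℂ → ℂ ⧸ L.lattice`. -/

namespace ComplexTorus

variable (L : PeriodPair)

theorem isLocalHomeomorph_mkQ : IsLocalHomeomorph (L.lattice.mkQ : ℂ → ℂ ⧸ L.lattice) := by
  have hd : IsDiscrete (L.lattice.toAddSubgroup : Set ℂ) :=
    ⟨(inferInstance : DiscreteTopology L.lattice)⟩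
  have h := (AddSubgroup.isAddQuotientCoveringMap_of_comm L.lattice.toAddSubgroup hd).isCoveringMap
  exact h.isLocalHomeomorph

instance instChartedSpace : ChartedSpace ℂ (ℂ ⧸ L.lattice) :=
  (isLocalHomeomorph_mkQ L).chartedSpace L.lattice.mkQ_surjective

variable {L}

/-- The charts are exactly local sections of the projection. -/
theorem mkQ_apply_of_mem_atlas {e : OpenPartialHomeomorph (ℂ ⧸ L.lattice) ℂ}
    (he : e ∈ atlas ℂ (ℂ ⧸ L.lattice)) {q : ℂ ⧸ L.lattice} (hq : q ∈ e.source) :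
    L.lattice.mkQ (e q) = q := by
  obtain ⟨r, rfl⟩ := he
  simp only [chartAt_self_eq, OpenPartialHomeomorph.trans_refl] at hq ⊢
  exact (isLocalHomeomorph_mkQ L).apply_localInverseAt_of_mem hq

theorem symm_apply_of_mem_atlas {e : OpenPartialHomeomorph (ℂ ⧸ L.lattice) ℂ}
    (he : e ∈ atlas ℂ (ℂ ⧸ L.lattice)) {z : ℂ} (hz : z ∈ e.target) :
    e.symm z = L.lattice.mkQ z := by
  have := mkQ_apply_of_mem_atlas he (e.map_target hz)
  rw [e.right_inv hz] at this
  exact this.symm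

instance instIsManifold : IsManifold 𝓘(ℂ) ω (ℂ ⧸ L.lattice) := by
  apply isManifold_of_contDiffOn
  intro e e' he he'
  simp only [modelWithCornersSelf_coe, modelWithCornersSelf_coe_symm, Function.id_comp,
    Function.comp_id, Set.range_id, Set.preimage_id, Set.inter_univ]
  intro z hz
  set τ := e.symm.trans e' with hτ
  have hτo : IsOpen τ.source := τ.open_source
  have key : ∀ w ∈ τ.source, τ w - w ∈ L.lattice := by
    intro w hw
    rw [hτ, OpenPartialHomeomorph.trans_source] at hw
    have h1 : L.lattice.mkQ (τ w) = e.symm w := mkQ_apply_of_mem_atlas he' hw.2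
    rw [symm_apply_of_mem_atlas he hw.1] at h1
    exact (Submodule.Quotient.eq _).1 h1
  have hcont : ContinuousAt (fun w => τ w - w) z :=
    (τ.continuousAt hz).sub continuousAt_id
  have hev : ∀ᶠ w in 𝓝 z, τ w = w + (τ z - z) := by
    have hU : (↑L.lattice \ {τ z - z} : Set ℂ)ᶜ ∈ 𝓝 (τ z - z) :=
      L.compl_lattice_sdiff_singleton_mem_nhds _
    filter_upwards [hcont hU, hτo.mem_nhds hz] with w hw hws
    have : τ w - w = τ z - z := by
      by_contra hne
      exact hw ⟨key w hws, hne⟩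
    linear_combination this
  have : ContDiffAt ℂ ω (fun w => w + (τ z - z)) z := by fun_prop
  exact (this.congr_of_eventuallyEq hev).contDiffWithinAt

end ComplexTorus

/-! ### The Fermat cubic in `ℂℙ²` as a Riemann surface -/

/-- The complex projective plane. -/
abbrev CP2 : Type := ℙ ℂ (Fin 3 → ℂ)

/-- The quotient topology of `ℂ³ ∖ {0} → ℂℙ²`. -/
instance CP2.instTopologicalSpace : TopologicalSpace CP2 :=
  inferInstanceAs (TopologicalSpace (Quotient (projectivizationSetoid ℂ (Fin 3 → ℂ))))

namespace CP2

theorem isQuotientMap_mk' :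
    Topology.IsQuotientMap (Projectivization.mk' ℂ : {v : Fin 3 → ℂ // v ≠ 0} → CP2) :=
  isQuotientMap_quot_mk

/-- The point `[x : y : 1]` of the projective plane with affine coordinates `(x, y)`. -/
def affine (x y : ℂ) : CP2 :=
  Projectivization.mk ℂ ![x, y, 1] (fun h => one_ne_zero (congrFun h 2))

/-- The quotient `a_m / a_k` of two homogeneous coordinates of a point with `a_k ≠ 0`. -/
def ratio (m k : Fin 3) (p : CP2) : ℂ := p.rep m / p.rep k

theorem exists_rep_mk {v : Fin 3 → ℂ} (hv : v ≠ 0) :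
    ∃ a : ℂ, a ≠ 0 ∧ ∀ m, (Projectivization.mk ℂ v hv).rep m = a * v m := by
  obtain ⟨a, ha⟩ := Projectivization.exists_smul_eq_mk_rep ℂ v hv
  refine ⟨a, a.ne_zero, fun m => ?_⟩
  rw [← ha]
  rfl

theorem ratio_mk {v : Fin 3 → ℂ} (hv : v ≠ 0) (m k : Fin 3) :
    ratio m k (Projectivization.mk ℂ v hv) = v m / v k := by
  obtain ⟨a, ha, h⟩ := exists_rep_mk hv
  rw [ratio, h, h, mul_div_mul_left _ _ ha]

theorem rep_mk_ne_zero {v : Fin 3 → ℂ} (hv : v ≠ 0) (k : Fin 3) :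
    (Projectivization.mk ℂ v hv).rep k ≠ 0 ↔ v k ≠ 0 := by
  obtain ⟨a, ha, h⟩ := exists_rep_mk hv
  rw [h]
  simp [ha]

theorem isOpen_rep_ne_zero (k : Fin 3) : IsOpen {p : CP2 | p.rep k ≠ 0} := by
  rw [← isQuotientMap_mk'.isOpen_preimage]
  have : (Projectivization.mk' ℂ : {v : Fin 3 → ℂ // v ≠ 0} → CP2) ⁻¹' {p : CP2 | p.rep k ≠ 0}
      = {v | v.1 k ≠ 0} := by
    ext v
    exact rep_mk_ne_zero v.2 k
  rw [this]
  exact isOpen_ne_fun ((continuous_apply k).comp continuous_subtype_val) continuous_const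

theorem continuousOn_ratio (m k : Fin 3) : ContinuousOn (ratio m k) {p : CP2 | p.rep k ≠ 0} := by
  rw [isQuotientMap_mk'.continuousOn_isOpen_iff (isOpen_rep_ne_zero k)]
  have : ratio m k ∘ (Projectivization.mk' ℂ : {v : Fin 3 → ℂ // v ≠ 0} → CP2)
      = fun v => v.1 m / v.1 k := by
    ext v
    exact ratio_mk v.2 m k
  rw [this]
  refine ContinuousOn.div ((continuous_apply m).comp continuous_subtype_val).continuousOn
    ((continuous_apply k).comp continuous_subtype_val).continuousOn fun v hv => ?_
  exact (rep_mk_ne_zero v.2 k).1 hv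

end CP2

/-- The Fermat cubic `x³ + y³ = z³` in `ℂℙ²`, the projective closure of `x³ + y³ = 1`. -/
def FermatCubic : Type :=
  {p : CP2 // ∀ v ∈ p.submodule, v 0 ^ 3 + v 1 ^ 3 = v 2 ^ 3}

namespace FermatCubic

/-- The inclusion of the Fermat cubic into the projective plane. -/
def toCP2 (p : FermatCubic) : CP2 := p.1

/-- The subspace topology. -/
instance instTopologicalSpace : TopologicalSpace FermatCubic :=
  inferInstanceAs (TopologicalSpace
    {p : CP2 // ∀ v ∈ p.submodule, v 0 ^ 3 + v 1 ^ 3 = v 2 ^ 3})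

theorem continuous_toCP2 : Continuous toCP2 := continuous_subtype_val

/-- The signs in the symmetric form `x³ + y³ - z³ = 0` of the equation. -/
def sgn : Fin 3 → ℂ := ![1, 1, -1]

theorem sgn_mul_self (m : Fin 3) : sgn m * sgn m = 1 := by
  fin_cases m <;> simp [sgn]

theorem sgn_ne_zero (m : Fin 3) : sgn m ≠ 0 := fun h => by
  simpa [h] using sgn_mul_self m

theorem eqn_iff (σ : Equiv.Perm (Fin 3)) (v : Fin 3 → ℂ) :
    v 0 ^ 3 + v 1 ^ 3 = v 2 ^ 3 ↔
      sgn (σ 0) * v (σ 0) ^ 3 + sgn (σ 1) * v (σ 1) ^ 3 + sgn (σ 2) * v (σ 2) ^ 3 = 0 := by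
  have h := Equiv.sum_comp σ (fun m => sgn m * v m ^ 3)
  rw [Fin.sum_univ_three, Fin.sum_univ_three] at h
  rw [h]
  simp only [sgn, Matrix.cons_val]
  constructor <;> intro h <;> linear_combination h

/-- A point `[v]` of the Fermat cubic. -/
def mk (v : Fin 3 → ℂ) (hv : v ≠ 0) (h : v 0 ^ 3 + v 1 ^ 3 = v 2 ^ 3) : FermatCubic :=
  ⟨Projectivization.mk ℂ v hv, by
    intro w hw
    rw [Projectivization.submodule_mk, Submodule.mem_span_singleton] at hw
    obtain ⟨a, rfl⟩ := hw
    simp only [Pi.smul_apply, smul_eq_mul]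
    linear_combination a ^ 3 * h⟩

theorem rep_eqn (p : FermatCubic) :
    p.toCP2.rep 0 ^ 3 + p.toCP2.rep 1 ^ 3 = p.toCP2.rep 2 ^ 3 := by
  apply p.2
  change p.toCP2.rep ∈ p.toCP2.submodule
  rw [Projectivization.submodule_eq]
  exact Submodule.mem_span_singleton_self _

/-- The sector on which cubing is injective, with image the slit plane. -/
def sector : Set ℂ := {w | w ≠ 0 ∧ |w.arg| < Real.pi / 3}

theorem isOpen_sector : IsOpen sector := by
  have hpi := Real.pi_pos
  have : sector = Complex.slitPlane ∩ (fun w => |w.arg|) ⁻¹' Set.Iio (Real.pi / 3) := by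
    ext w
    simp only [sector, Set.mem_ofPred_eq, Set.mem_inter_iff, Set.mem_preimage, Set.mem_Iio]
    constructor
    · rintro ⟨h0, h1⟩
      refine ⟨Complex.mem_slitPlane_iff_arg.2 ⟨fun h => ?_, h0⟩, h1⟩
      rw [h, abs_of_pos hpi] at h1
      linarith
    · rintro ⟨h0, h1⟩
      exact ⟨Complex.slitPlane_ne_zero h0, h1⟩
  rw [this]
  refine ContinuousOn.isOpen_inter_preimage (fun w hw => ?_) Complex.isOpen_slitPlane isOpen_Iio
  exact (Complex.continuousAt_arg hw).abs.continuousWithinAt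

theorem cube_cpow {w : ℂ} (hw : w ∈ sector) : (w ^ 3) ^ (3⁻¹ : ℂ) = w := by
  have := abs_lt.1 hw.2
  exact Complex.pow_cpow_ofNat_inv (n := 3) this.1 this.2.le

theorem cpow_cube (u : ℂ) : (u ^ (3⁻¹ : ℂ)) ^ 3 = u :=
  Complex.cpow_nat_inv_pow u (n := 3) three_ne_zero

theorem cpow_mem_sector {u : ℂ} (hu : u ∈ Complex.slitPlane) : u ^ (3⁻¹ : ℂ) ∈ sector := by
  have hpi := Real.pi_pos
  have hu0 := Complex.slitPlane_ne_zero hu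
  refine ⟨by simp [Complex.cpow_eq_zero_iff, hu0], ?_⟩
  have h1 := Complex.neg_pi_lt_arg u
  have h2 := Complex.arg_le_pi u
  have h3 : u.arg < Real.pi := lt_of_le_of_ne h2 (Complex.mem_slitPlane_iff_arg.1 hu).1
  have him : (Complex.log u * (3⁻¹ : ℂ)).im = u.arg / 3 := by
    have : (3⁻¹ : ℂ) = ((3⁻¹ : ℝ) : ℂ) := by push_cast; rfl
    rw [this, Complex.im_mul_ofReal, Complex.log_im]
    ring
  have : (u ^ (3⁻¹ : ℂ)).arg = u.arg / 3 := by
    rw [Complex.cpow_def_of_ne_zero hu0, ← Complex.log_im,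
      Complex.log_exp (by rw [him]; linarith) (by rw [him]; linarith), him]
  rw [this, abs_lt]
  constructor <;> linarith

theorem cube_mem_slitPlane {w : ℂ} (hw : w ∈ sector) : w ^ 3 ∈ Complex.slitPlane := by
  have h := abs_lt.1 hw.2
  have hw3 : w ^ 3 = Complex.exp (3 * Complex.log w) := by
    rw [← Complex.exp_log hw.1, ← Complex.exp_nat_mul, Complex.exp_log hw.1]
    norm_num
  have him : (3 * Complex.log w).im = 3 * w.arg := by
    have : (3 : ℂ) = ((3 : ℝ) : ℂ) := by push_cast; rfl
    rw [this, Complex.im_ofReal_mul, Complex.log_im]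
  refine Complex.mem_slitPlane_iff_arg.2 ⟨?_, pow_ne_zero 3 hw.1⟩
  rw [hw3, ← Complex.log_im, Complex.log_exp (by rw [him]; linarith) (by rw [him]; linarith), him]
  intro h'
  linarith

/-! Given a numbering `i = σ 0`, `j = σ 1`, `k = σ 2` of the homogeneous coordinates, normalise
`a_k = 1`. Where `a_j ≠ 0`, the coordinate `t = a_i` is a local parameter, `a_j` being the branch
near `c` of the cube root of a polynomial in `t`. -/

/-- The polynomial whose cube roots are the values of `a_j`. -/
def cubePoly (σ : Equiv.Perm (Fin 3)) (t : ℂ) : ℂ :=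
  -(sgn (σ 1) * (sgn (σ 2) + sgn (σ 0) * t ^ 3))

/-- The branch of the cube root of `cubePoly σ t` that lies in `c • sector`. -/
def branch (σ : Equiv.Perm (Fin 3)) (c t : ℂ) : ℂ := c * (cubePoly σ t / c ^ 3) ^ (3⁻¹ : ℂ)

/-- Homogeneous coordinates of the point with parameter `t`. -/
def vec (σ : Equiv.Perm (Fin 3)) (c t : ℂ) : Fin 3 → ℂ := fun m => ![t, branch σ c t, 1] (σ.symm m)

section vec

variable (σ : Equiv.Perm (Fin 3)) (c t : ℂ)

@[simp] theorem vec_zero : vec σ c t (σ 0) = t := by simp [vec]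
@[simp] theorem vec_one : vec σ c t (σ 1) = branch σ c t := by simp [vec]
@[simp] theorem vec_two : vec σ c t (σ 2) = 1 := by simp [vec]

theorem vec_ne_zero : vec σ c t ≠ 0 := fun h => by
  have := congrFun h (σ 2)
  simp at this

variable {c}

theorem branch_cube (hc : c ≠ 0) : branch σ c t ^ 3 = cubePoly σ t := by
  rw [branch, mul_pow, cpow_cube]
  field_simp

theorem vec_eqn (hc : c ≠ 0) : vec σ c t 0 ^ 3 + vec σ c t 1 ^ 3 = vec σ c t 2 ^ 3 := by
  rw [eqn_iff σ, vec_zero, vec_one, vec_two, branch_cube σ t hc, cubePoly]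
  linear_combination (-(sgn (σ 2) + sgn (σ 0) * t ^ 3)) * sgn_mul_self (σ 1)

/-- For a point with `a_k ≠ 0`, the cube of `a_j / a_k`. -/
theorem ratio_cube (p : FermatCubic) (hp : p.toCP2.rep (σ 2) ≠ 0) :
    CP2.ratio (σ 1) (σ 2) p.toCP2 ^ 3 = cubePoly σ (CP2.ratio (σ 0) (σ 2) p.toCP2) := by
  have h := (eqn_iff σ _).1 p.rep_eqn
  have h1 := sgn_mul_self (σ 1)
  rw [CP2.ratio, CP2.ratio, cubePoly]
  field_simp
  linear_combination sgn (σ 1) * h - p.toCP2.rep (σ 1) ^ 3 * h1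

end vec

/-- The chart `p ↦ a_i / a_k` on the open set `a_k ≠ 0`, `a_j / a_k ∈ c • sector`. -/
def chart (σ : Equiv.Perm (Fin 3)) (c : ℂ) (hc : c ≠ 0) :
    OpenPartialHomeomorph FermatCubic ℂ where
  toFun p := CP2.ratio (σ 0) (σ 2) p.toCP2
  invFun t := mk (vec σ c t) (vec_ne_zero σ c t) (vec_eqn σ t hc)
  source := {p | p.toCP2.rep (σ 2) ≠ 0 ∧ CP2.ratio (σ 1) (σ 2) p.toCP2 / c ∈ sector}
  target := {t | cubePoly σ t / c ^ 3 ∈ Complex.slitPlane}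
  map_source' p hp := by
    have := cube_mem_slitPlane hp.2
    rwa [div_pow, ratio_cube σ p hp.1] at this
  map_target' t ht := by
    refine ⟨(CP2.rep_mk_ne_zero (vec_ne_zero σ c t) _).2 (by simp), ?_⟩
    have : CP2.ratio (σ 1) (σ 2)
        (mk (vec σ c t) (vec_ne_zero σ c t) (vec_eqn σ t hc)).toCP2 = branch σ c t := by
      refine (CP2.ratio_mk (vec_ne_zero σ c t) _ _).trans ?_
      simp
    rw [this, branch, mul_div_cancel_left₀ _ hc]
    exact cpow_mem_sector ht
  left_inv' p hp := by
    obtain ⟨hp1, hp2⟩ := hp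
    apply Subtype.ext
    change Projectivization.mk ℂ _ _ = p.toCP2
    rw [← Projectivization.mk_rep p.toCP2, Projectivization.mk_eq_mk_iff']
    refine ⟨(p.toCP2.rep (σ 2))⁻¹, ?_⟩
    rw [Projectivization.mk_rep]
    have hb : branch σ c (CP2.ratio (σ 0) (σ 2) p.toCP2) = CP2.ratio (σ 1) (σ 2) p.toCP2 := by
      rw [branch, ← ratio_cube σ p hp1, ← div_pow, cube_cpow hp2]
      field_simp
    funext m
    obtain ⟨m, rfl⟩ := σ.surjective m
    simp only [Pi.smul_apply, smul_eq_mul]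
    fin_cases m
    · change _ * p.toCP2.rep (σ 0) = vec σ c _ (σ 0)
      rw [vec_zero, CP2.ratio]
      ring
    · change _ * p.toCP2.rep (σ 1) = vec σ c _ (σ 1)
      rw [vec_one, hb, CP2.ratio]
      ring
    · change _ * p.toCP2.rep (σ 2) = vec σ c _ (σ 2)
      rw [vec_two]
      exact inv_mul_cancel₀ hp1
  right_inv' t ht := by
    refine (CP2.ratio_mk (vec_ne_zero σ c t) _ _).trans ?_
    simp
  open_source := by
    have h : ContinuousOn (fun p : FermatCubic => CP2.ratio (σ 1) (σ 2) p.toCP2 / c)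
        {p | p.toCP2.rep (σ 2) ≠ 0} :=
      ((CP2.continuousOn_ratio _ _).comp continuous_toCP2.continuousOn fun _ hp => hp).div_const c
    exact h.isOpen_inter_preimage ((CP2.isOpen_rep_ne_zero _).preimage continuous_toCP2)
      isOpen_sector
  open_target := Complex.isOpen_slitPlane.preimage (by unfold cubePoly; fun_prop)
  continuousOn_toFun :=
    (CP2.continuousOn_ratio _ _).comp continuous_toCP2.continuousOn fun _ hp => hp.1
  continuousOn_invFun := by
    refine Topology.IsInducing.subtypeVal.continuousOn_iff.2 ?_
    refine CP2.isQuotientMap_mk'.continuous.comp_continuousOn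
      (f := fun t => (⟨vec σ c t, vec_ne_zero σ c t⟩ : {v : Fin 3 → ℂ // v ≠ 0})) ?_
    refine Topology.IsInducing.subtypeVal.continuousOn_iff.2 ?_
    refine continuousOn_pi.2 fun m => ?_
    obtain ⟨m, rfl⟩ := σ.surjective m
    fin_cases m
    · simpa using! continuousOn_id
    · have : ContinuousOn (branch σ c) {t | cubePoly σ t / c ^ 3 ∈ Complex.slitPlane} := by
        unfold branch
        refine continuousOn_const.mul (ContinuousOn.cpow_const ?_ fun t ht => ht)
        unfold cubePoly
        fun_prop
      simpa using this
    · simpa using continuousOn_const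

/-- On the Fermat cubic at least two homogeneous coordinates do not vanish. -/
theorem exists_perm (p : FermatCubic) :
    ∃ σ : Equiv.Perm (Fin 3), p.toCP2.rep (σ 1) ≠ 0 ∧ p.toCP2.rep (σ 2) ≠ 0 := by
  have h := p.rep_eqn
  have h0 := p.toCP2.rep_nonzero
  by_cases h2 : p.toCP2.rep 2 = 0
  · have h1 : p.toCP2.rep 1 ≠ 0 := by
      intro h1
      apply h0
      have : p.toCP2.rep 0 = 0 := by simpa [h1, h2] using h
      funext m
      fin_cases m <;> assumption
    refine ⟨Equiv.swap 0 2, h1, ?_⟩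
    rw [Equiv.swap_apply_right]
    intro h0'
    simp [h2, h0', h1] at h
  · by_cases h1 : p.toCP2.rep 1 = 0
    · refine ⟨Equiv.swap 0 1, ?_, h2⟩
      rw [Equiv.swap_apply_right]
      intro h0'
      rw [h0', h1] at h
      exact h2 (pow_eq_zero_iff three_ne_zero |>.1 (by simpa using h.symm))
    · exact ⟨1, h1, h2⟩

/-- The charts given by quotients of homogeneous coordinates. -/
instance instChartedSpace : ChartedSpace ℂ FermatCubic where
  atlas := {e | ∃ (σ : Equiv.Perm (Fin 3)) (c : ℂ) (hc : c ≠ 0), e = chart σ c hc}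
  chartAt p := chart p.exists_perm.choose
    (CP2.ratio (p.exists_perm.choose 1) (p.exists_perm.choose 2) p.toCP2)
    (div_ne_zero p.exists_perm.choose_spec.1 p.exists_perm.choose_spec.2)
  mem_chart_source p := by
    refine ⟨p.exists_perm.choose_spec.2, ?_⟩
    have h := div_ne_zero p.exists_perm.choose_spec.1 p.exists_perm.choose_spec.2
    change CP2.ratio _ _ _ ≠ 0 at h
    rw [div_self h]
    refine ⟨one_ne_zero, ?_⟩
    simpa using Real.pi_pos
  chart_mem_atlas p := ⟨_, _, _, rfl⟩

instance instIsManifold : IsManifold 𝓘(ℂ) ω FermatCubic := by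
  apply isManifold_of_contDiffOn
  rintro e e' ⟨σ, c, hc, rfl⟩ ⟨σ', c', hc', rfl⟩
  simp only [modelWithCornersSelf_coe, modelWithCornersSelf_coe_symm, Function.id_comp,
    Function.comp_id, Set.range_id, Set.preimage_id, Set.inter_univ]
  intro t ht
  rw [OpenPartialHomeomorph.trans_source] at ht
  obtain ⟨ht1, ht2⟩ := ht
  have ht1 : cubePoly σ t / c ^ 3 ∈ Complex.slitPlane := ht1
  have hk : vec σ c t (σ' 2) ≠ 0 := (CP2.rep_mk_ne_zero (vec_ne_zero σ c t) _).1 ht2.1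
  have hvec : ∀ m, ContDiffAt ℂ ω (fun t => vec σ c t m) t := by
    intro m
    obtain ⟨m, rfl⟩ := σ.surjective m
    fin_cases m
    · simpa using! contDiffAt_id
    · have : ContDiffAt ℂ ω (branch σ c) t := by
        have hA : AnalyticAt ℂ (fun t => cubePoly σ t / c ^ 3) t := by
          unfold cubePoly
          fun_prop
        exact (analyticAt_const.mul (hA.cpow analyticAt_const ht1)).contDiffAt
      simpa using this
    · simpa using contDiffAt_const
  have hfun : ((chart σ c hc).symm.trans (chart σ' c' hc') : ℂ → ℂ) =
      fun t => vec σ c t (σ' 0) / vec σ c t (σ' 2) := by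
    funext t
    exact CP2.ratio_mk (vec_ne_zero σ c t) _ _
  rw [hfun]
  exact ((hvec _).div (hvec _) hk).contDiffWithinAt

end FermatCubic

/-! ### The elliptic functions -/

/-- `(1 - 3^{-1/2} ℘') / (2 ℘)` for the lattice `L`. -/
def bakerF (L : PeriodPair) (z : ℂ) : ℂ :=
  1 / (2 * L.weierstrassP z) * (1 - ((√3 : ℝ) : ℂ)⁻¹ * L.derivWeierstrassP z)

/-- `(1 + 3^{-1/2} ℘') / (2 ℘)` for the lattice `L`. -/
def bakerG (L : PeriodPair) (z : ℂ) : ℂ :=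
  1 / (2 * L.weierstrassP z) * (1 + ((√3 : ℝ) : ℂ)⁻¹ * L.derivWeierstrassP z)

end

/-! Put x = ℘, y = ℘'/√3. The equation (℘')² = 4℘³ - 1 says exactly that [1 - y : 1 + y : 2x] lies
on the Fermat cubic, and the lattice points go to [1 : -1 : 0]. Injectivity modulo the lattice holds
because ℘ and ℘' at one point are initial data for ℘'' = 6℘² - g₂/2 (`sub_mem_lattice_of_eq`);
surjectivity comes from Liouville's theorem (`exists_weierstrassP_eq`) and the parity of ℘ and ℘'.
The 2 × 2 minors of a local lift and its derivative are nonzero multiples of the partial derivatives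
of the cubic (`exists_analyticAt_lift`), so the map has nonzero derivative in every chart and its
inverse is holomorphic.

Write f, g for `bakerF`, `bakerG`; they satisfy f' = -√3 g², g' = √3 f². For meromorphic F, G with
F³ + G³ = 1 and W = FG' - F'G, differentiation gives F' = -G²W, G' = F²W. Since W has no poles
(`meromorphicOrderAt_wronskian_nonneg`), W/√3 has an entire primitive α. With the right initial
value, (f ∘ α, g ∘ α) and (F, G) solve the same system, so they agree locally, and by the identity
theorem everywhere off a discrete set. -/

noncomputable section

open Filter Set

/-! ### Uniqueness for holomorphic differential equations. -/

/-- A holomorphic function with `‖d'‖ ≤ K ‖d‖` that vanishes at a point vanishes near it. -/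
theorem eventually_eq_zero_of_norm_deriv_le {E : Type*} [NormedAddCommGroup E] [NormedSpace ℂ E]
    {d d' : ℂ → E} {K : ℝ} {z₀ : ℂ} (hd : ∀ᶠ z in 𝓝 z₀, HasDerivAt d (d' z) z)
    (hK : ∀ᶠ z in 𝓝 z₀, ‖d' z‖ ≤ K * ‖d z‖) (h0 : d z₀ = 0) : ∀ᶠ z in 𝓝 z₀, d z = 0 := by
  obtain ⟨r, hr, hball⟩ := Metric.eventually_nhds_iff_ball.1 (hd.and hK)
  refine Metric.eventually_nhds_iff_ball.2 ⟨r, hr, fun z hz => ?_⟩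
  -- Restricting to the segment from z₀ to z leaves a Grönwall estimate in one real variable; the
  -- chain rule puts the factor ‖z - z₀‖ into the constant.
  have hseg : ∀ t ∈ Icc (0 : ℝ) 1, z₀ + (t : ℂ) * (z - z₀) ∈ Metric.ball z₀ r := by
    intro t ht
    rw [Metric.mem_ball, dist_eq_norm] at hz ⊢
    rw [add_sub_cancel_left, norm_mul, Complex.norm_real, Real.norm_of_nonneg ht.1]
    exact (mul_le_of_le_one_left (norm_nonneg _) ht.2).trans_lt hz
  have hder : ∀ t ∈ Icc (0 : ℝ) 1, HasDerivAt (fun t : ℝ => d (z₀ + (t : ℂ) * (z - z₀)))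
      ((z - z₀) • d' (z₀ + (t : ℂ) * (z - z₀))) t := by
    intro t ht
    have h1 : HasDerivAt (fun t : ℝ => z₀ + (t : ℂ) * (z - z₀)) (z - z₀) t := by
      simpa using ((Complex.ofRealCLM.hasDerivAt (x := t)).mul_const (z - z₀)).const_add z₀
    exact (hball _ (hseg t ht)).1.scomp t h1
  have := eq_zero_of_abs_deriv_le_mul_abs_self_of_eq_zero_right
    (f := fun t : ℝ => d (z₀ + (t : ℂ) * (z - z₀))) (K := ‖z - z₀‖ * K) (a := 0) (b := 1)
    (fun t ht => (hder t ht).continuousAt.continuousWithinAt)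
    (fun t ht => (hder t (Ico_subset_Icc_self ht)).hasDerivWithinAt) (by simpa using h0)
    (fun t ht => by
      rw [norm_smul, mul_assoc]
      exact mul_le_mul_of_nonneg_left (hball _ (hseg t (Ico_subset_Icc_self ht))).2
        (norm_nonneg _)) 1 (right_mem_Icc.2 zero_le_one)
  simpa using this

/-! ### Differential equation, injectivity and surjectivity for ℘. -/

namespace PeriodPair

variable (L : PeriodPair)

theorem eventually_notMem_lattice {z : ℂ} (hz : z ∉ L.lattice) : ∀ᶠ w in 𝓝 z, w ∉ L.lattice :=
  L.isClosed_lattice.isOpen_compl.mem_nhds hz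

theorem eventually_nhdsNE_notMem_lattice (z : ℂ) : ∀ᶠ w in 𝓝[≠] z, w ∉ L.lattice := by
  filter_upwards [self_mem_nhdsWithin,
    mem_nhdsWithin_of_mem_nhds (L.compl_lattice_sdiff_singleton_mem_nhds z)] with w hw hw'
  exact fun h => hw' ⟨h, hw⟩

theorem hasDerivAt_weierstrassP {z : ℂ} (hz : z ∉ L.lattice) :
    HasDerivAt L.weierstrassP (L.derivWeierstrassP z) z := by
  have := (L.analyticOnNhd_weierstrassP z hz).differentiableAt.hasDerivAt
  rwa [L.deriv_weierstrassP] at this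

theorem weierstrassP_tendsto_cobounded {l : ℂ} (hl : l ∈ L.lattice) :
    Tendsto L.weierstrassP (𝓝[≠] l) (Bornology.cobounded ℂ) := by
  apply tendsto_cobounded_of_meromorphicOrderAt_neg
  rw [L.order_weierstrassP l hl]
  decide

/-- `℘'` does not vanish on a punctured neighbourhood of any point. -/
theorem eventually_derivWeierstrassP_ne_zero (z : ℂ) :
    ∀ᶠ w in 𝓝[≠] z, L.derivWeierstrassP w ≠ 0 := by
  have h0 : meromorphicOrderAt L.derivWeierstrassP 0 ≠ ⊤ := by
    have h := meromorphicOrderAt_deriv_eq_sub_one (n := -2) (by norm_num)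
      (L.order_weierstrassP 0 L.lattice.zero_mem)
    rw [L.deriv_weierstrassP] at h
    rw [h]
    decide
  have h1 := L.meromorphic_derivWeierstrassP.meromorphicOn.meromorphicOrderAt_ne_top_of_isPreconnected
    isPreconnected_univ (mem_univ 0) (mem_univ z) h0
  exact (meromorphicOrderAt_ne_top_iff_eventually_ne_zero
    (L.meromorphic_derivWeierstrassP z)).1 h1

/-- The differential equation `℘'' = 6 ℘² - g₂ / 2`. -/
theorem hasDerivAt_derivWeierstrassP {z : ℂ} (hz : z ∉ L.lattice) :
    HasDerivAt L.derivWeierstrassP (6 * L.weierstrassP z ^ 2 - L.g₂ / 2) z := by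
  have hd : ∀ w, w ∉ L.lattice →
      HasDerivAt L.derivWeierstrassP (deriv L.derivWeierstrassP w) w := fun w hw =>
    (L.analyticOnNhd_derivWeierstrassP w hw).differentiableAt.hasDerivAt
  -- Differentiating the equation for (℘')² gives the claim multiplied by 2℘'. The zeros of ℘' are
  -- isolated, so ℘' cancels near z, and continuity gives the value at z itself.
  have h1 : ∀ᶠ w in 𝓝[≠] z,
      deriv L.derivWeierstrassP w = 6 * L.weierstrassP w ^ 2 - L.g₂ / 2 := by
    filter_upwards [L.eventually_derivWeierstrassP_ne_zero z,
      L.eventually_nhdsNE_notMem_lattice z] with w hw hwL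
    have e1 := (hd w hwL).pow 2
    have e2 := ((((L.hasDerivAt_weierstrassP hwL).pow 3).const_mul 4).sub
      ((L.hasDerivAt_weierstrassP hwL).const_mul L.g₂)).sub_const L.g₃
    have e3 := e1.congr_of_eventuallyEq (f₁ := fun u => 4 * L.weierstrassP u ^ 3
      - L.g₂ * L.weierstrassP u - L.g₃) (by
        filter_upwards [L.eventually_notMem_lattice hwL] with u hu
        exact (L.derivWeierstrassP_sq u hu).symm)
    have e4 := e3.unique e2
    have : 2 * L.derivWeierstrassP w * (deriv L.derivWeierstrassP w
        - (6 * L.weierstrassP w ^ 2 - L.g₂ / 2)) = 0 := by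
      push_cast at e4
      norm_num at e4
      linear_combination e4
    rcases mul_eq_zero.1 this with h | h
    · exact absurd (by simpa using h) hw
    · exact sub_eq_zero.1 h
  have hc1 : ContinuousAt (deriv L.derivWeierstrassP) z :=
    (L.analyticOnNhd_derivWeierstrassP z hz).deriv.continuousAt
  have hc2 : ContinuousAt (fun w => 6 * L.weierstrassP w ^ 2 - L.g₂ / 2) z :=
    (((L.hasDerivAt_weierstrassP hz).continuousAt.pow 2).const_mul 6).sub_const _
  have h2 := tendsto_nhds_unique_of_eventuallyEq (hc1.mono_left nhdsWithin_le_nhds)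
    (hc2.mono_left nhdsWithin_le_nhds) h1
  exact (hd z hz).congr_deriv h2

/-- The values of `℘` and `℘'` determine a point modulo the lattice. -/
theorem sub_mem_lattice_of_eq {z w : ℂ} (hz : z ∉ L.lattice) (hw : w ∉ L.lattice)
    (h : L.weierstrassP z = L.weierstrassP w)
    (h' : L.derivWeierstrassP z = L.derivWeierstrassP w) : z - w ∈ L.lattice := by
  set c := z - w with hc
  have hwc : w + c = z := by rw [hc]; ring
  have hloc : ∀ᶠ t in 𝓝 w, L.weierstrassP (t + c) - L.weierstrassP t = 0 := by
    have hT : Tendsto (fun t => t + c) (𝓝 w) (𝓝 z) := by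
      rw [← hwc]; exact (continuous_add_const c).continuousAt
    have e1 := (L.eventually_notMem_lattice hw).and (hT.eventually (L.eventually_notMem_lattice hz))
    have hder : ∀ᶠ t in 𝓝 w, HasDerivAt (fun t => ((L.weierstrassP (t + c) - L.weierstrassP t,
        L.derivWeierstrassP (t + c) - L.derivWeierstrassP t) : ℂ × ℂ))
        (L.derivWeierstrassP (t + c) - L.derivWeierstrassP t,
          (6 * L.weierstrassP (t + c) ^ 2 - L.g₂ / 2) - (6 * L.weierstrassP t ^ 2 - L.g₂ / 2)) t := by
      filter_upwards [e1] with t ht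
      exact (((L.hasDerivAt_weierstrassP ht.2).comp_add_const t c).sub
          (L.hasDerivAt_weierstrassP ht.1)).prodMk
        (((L.hasDerivAt_derivWeierstrassP ht.2).comp_add_const t c).sub
          (L.hasDerivAt_derivWeierstrassP ht.1))
    have hcont : ContinuousAt (fun t => ‖6 * (L.weierstrassP (t + c) + L.weierstrassP t)‖) w := by
      have hz' := (L.hasDerivAt_weierstrassP hz).continuousAt
      rw [← hwc] at hz'
      exact (((hz'.comp (f := fun t => t + c) (continuous_add_const c).continuousAt).add
        (L.hasDerivAt_weierstrassP hw).continuousAt).const_mul 6).norm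
    obtain ⟨M, hM⟩ : ∃ M, ∀ᶠ t in 𝓝 w,
        ‖6 * (L.weierstrassP (t + c) + L.weierstrassP t)‖ ≤ M :=
      ⟨_, (hcont.eventually (gt_mem_nhds (lt_add_one _))).mono fun _ h => h.le⟩
    -- In the sup norm, the constant 1 serves the first component, whose derivative is the second; M
    -- serves the second, since 6℘² differences factor through differences of ℘.
    have := eventually_eq_zero_of_norm_deriv_le (K := max 1 M) hder (by
      filter_upwards [hM] with t ht
      refine max_le ?_ ?_
      · refine (norm_snd_le (L.weierstrassP (t + c) - L.weierstrassP t,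
          L.derivWeierstrassP (t + c) - L.derivWeierstrassP t)).trans ?_
        exact le_mul_of_one_le_left (norm_nonneg _) (le_max_left _ _)
      · have : (6 * L.weierstrassP (t + c) ^ 2 - L.g₂ / 2) - (6 * L.weierstrassP t ^ 2 - L.g₂ / 2)
            = (6 * (L.weierstrassP (t + c) + L.weierstrassP t)) *
              (L.weierstrassP (t + c) - L.weierstrassP t) := by ring
        rw [this, norm_mul]
        refine mul_le_mul (ht.trans (le_max_right _ _)) ?_ (norm_nonneg _)
          (zero_le_one.trans (le_max_left _ _))
        exact norm_fst_le (L.weierstrassP (t + c) - L.weierstrassP t,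
          L.derivWeierstrassP (t + c) - L.derivWeierstrassP t)) (by simp [hwc, h, h'])
    exact this.mono fun t ht => congrArg Prod.fst ht
  have hmer : Meromorphic (fun t => L.weierstrassP (t + c) - L.weierstrassP t) := by
    have := L.meromorphic_weierstrassP
    exact Meromorphic.fun_sub (fun t => (meromorphicAt_comp_add_const_iff_meromorphicAt
      (f := L.weierstrassP)).2 (this _)) this
  have htop : meromorphicOrderAt (fun t => L.weierstrassP (t + c) - L.weierstrassP t) 0 = ⊤ := by
    by_contra hne
    exact hmer.meromorphicOn.meromorphicOrderAt_ne_top_of_isPreconnected isPreconnected_univ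
      (mem_univ 0) (mem_univ w) hne
      (meromorphicOrderAt_eq_top_iff.2 (hloc.filter_mono nhdsWithin_le_nhds))
  have h0 := meromorphicOrderAt_eq_top_iff.1 htop
  -- By now ℘(t + c) = ℘(t) near t = 0. The right side has a pole there, whereas the left side is
  -- continuous if c is not in the lattice.
  by_contra hcL
  have hca : Tendsto (fun t => L.weierstrassP (t + c)) (𝓝[≠] 0) (𝓝 (L.weierstrassP (0 + c))) := by
    have : ContinuousAt L.weierstrassP (0 + c) := by
      rw [zero_add]; exact (L.hasDerivAt_weierstrassP hcL).continuousAt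
    exact (this.comp (f := fun t => t + c) (continuous_add_const c).continuousAt).mono_left
      nhdsWithin_le_nhds
  have hcob : Tendsto L.weierstrassP (𝓝[≠] 0) (Bornology.cobounded ℂ) :=
    L.weierstrassP_tendsto_cobounded L.lattice.zero_mem
  have hcob' : Tendsto (fun t => L.weierstrassP (t + c)) (𝓝[≠] 0) (Bornology.cobounded ℂ) :=
    hcob.congr' (h0.mono fun t ht => (sub_eq_zero.1 ht).symm)
  exact not_tendsto_nhds_of_tendsto_atTop (tendsto_norm_cobounded_atTop.comp hcob') _ hca.norm

/-- If ℘ omitted c, then 1/(℘ - c), extended by 0 to the lattice, would be entire and periodic,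
hence bounded and constant. It vanishes at 0 but not at ω₁/2. -/
theorem exists_weierstrassP_eq (c : ℂ) : ∃ z, z ∉ L.lattice ∧ L.weierstrassP z = c := by
  classical
  by_contra! hne
  set h : ℂ → ℂ := fun z => if z ∈ L.lattice then 0 else (L.weierstrassP z - c)⁻¹ with hh
  have hoff : ∀ z, z ∉ L.lattice → h =ᶠ[𝓝 z] fun z => (L.weierstrassP z - c)⁻¹ := by
    intro z hz
    filter_upwards [L.eventually_notMem_lattice hz] with w hw
    simp [hh, hw]
  have hdoff : ∀ z, z ∉ L.lattice → DifferentiableAt ℂ h z := by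
    intro z hz
    refine DifferentiableAt.congr_of_eventuallyEq ?_ (hoff z hz)
    exact ((L.hasDerivAt_weierstrassP hz).differentiableAt.sub_const c).inv
      (sub_ne_zero.2 (hne z hz))
  have hd : Differentiable ℂ h := by
    intro z
    by_cases hz : z ∈ L.lattice
    · refine (Complex.analyticAt_of_differentiable_on_punctured_nhds_of_continuousAt
        ((L.eventually_nhdsNE_notMem_lattice z).mono hdoff) ?_).differentiableAt
      rw [continuousAt_iff_punctured_nhds]
      have : h z = 0 := by simp [hh, hz]
      rw [this]
      have hT : Tendsto (fun w => L.weierstrassP w - c) (𝓝[≠] z) (Bornology.cobounded ℂ) :=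
        (tendsto_sub_const_cobounded c).comp (L.weierstrassP_tendsto_cobounded hz)
      refine (tendsto_inv₀_cobounded.comp hT).congr' ?_
      filter_upwards [L.eventually_nhdsNE_notMem_lattice z] with w hw
      simp [hh, hw]
    · exact hdoff z hz
  have hper : ∀ z w, w ∈ L.lattice → h (z + w) = h z := by
    intro z w hw
    have : z + w ∈ L.lattice ↔ z ∈ L.lattice := L.lattice.add_mem_iff_left hw
    simp only [hh, this, L.weierstrassP_add_coe z ⟨w, hw⟩]
  have hb := (IsZLattice.isCompact_range_of_periodic L.lattice h hd.continuous
    fun z w hw => hper z w hw).isBounded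
  have h1 := hd.apply_eq_apply_of_bounded hb (L.ω₁ / 2) 0
  have hω := L.ω₁_div_two_notMem_lattice
  simp only [hh, hω, L.lattice.zero_mem, if_true, if_false] at h1
  exact sub_ne_zero.2 (hne _ hω) (inv_eq_zero.1 h1)

end PeriodPair

/-! ### The affine parametrisation of x³ + y³ = 1. -/

theorem ofReal_sqrt_three_sq : ((√3 : ℝ) : ℂ) ^ 2 = 3 := by
  rw [← Complex.ofReal_pow, Real.sq_sqrt (by norm_num)]
  norm_num

theorem ofReal_sqrt_three_ne_zero : ((√3 : ℝ) : ℂ) ≠ 0 := fun h => by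
  simpa [h] using ofReal_sqrt_three_sq

section Baker

variable {L : PeriodPair}

theorem meromorphic_bakerF : Meromorphic (bakerF L) := by
  have := L.meromorphic_weierstrassP
  have := L.meromorphic_derivWeierstrassP
  unfold bakerF
  fun_prop

theorem meromorphic_bakerG : Meromorphic (bakerG L) := by
  have := L.meromorphic_weierstrassP
  have := L.meromorphic_derivWeierstrassP
  unfold bakerG
  fun_prop

theorem derivWeierstrassP_sq_of_g₂_eq_zero (hg₂ : L.g₂ = 0) (hg₃ : L.g₃ = 1) {z : ℂ}
    (hz : z ∉ L.lattice) : L.derivWeierstrassP z ^ 2 = 4 * L.weierstrassP z ^ 3 - 1 := by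
  rw [L.derivWeierstrassP_sq z hz, hg₂, hg₃]
  ring

theorem hasDerivAt_derivWeierstrassP_of_g₂_eq_zero (hg₂ : L.g₂ = 0) {z : ℂ}
    (hz : z ∉ L.lattice) : HasDerivAt L.derivWeierstrassP (6 * L.weierstrassP z ^ 2) z := by
  simpa [hg₂] using L.hasDerivAt_derivWeierstrassP hz

/-- Together with `hasDerivAt_bakerG` this says that the invariant differential x dy - y dx pulls
back to √3 dz. -/
theorem hasDerivAt_bakerF (hg₂ : L.g₂ = 0) (hg₃ : L.g₃ = 1) {z : ℂ} (hz : z ∉ L.lattice)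
    (h0 : L.weierstrassP z ≠ 0) :
    HasDerivAt (bakerF L) (-((√3 : ℝ) : ℂ) * bakerG L z ^ 2) z := by
  have h1 := L.hasDerivAt_weierstrassP hz
  have h2 := hasDerivAt_derivWeierstrassP_of_g₂_eq_zero hg₂ hz
  have h3 := derivWeierstrassP_sq_of_g₂_eq_zero hg₂ hg₃ hz
  have h := (((h1.const_mul 2).fun_inv (mul_ne_zero two_ne_zero h0)).const_mul 1).fun_mul
    ((h2.const_mul ((√3 : ℝ) : ℂ)⁻¹).const_sub 1)
  simp only [← div_eq_mul_inv] at h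
  refine h.congr_deriv ?_
  have hk := ofReal_sqrt_three_sq
  have hk0 := ofReal_sqrt_three_ne_zero
  rw [bakerG]
  generalize ((√3 : ℝ) : ℂ) = κ at *
  field_simp
  linear_combination 3 * h3 + hk

theorem hasDerivAt_bakerG (hg₂ : L.g₂ = 0) (hg₃ : L.g₃ = 1) {z : ℂ} (hz : z ∉ L.lattice)
    (h0 : L.weierstrassP z ≠ 0) :
    HasDerivAt (bakerG L) (((√3 : ℝ) : ℂ) * bakerF L z ^ 2) z := by
  have h1 := L.hasDerivAt_weierstrassP hz
  have h2 := hasDerivAt_derivWeierstrassP_of_g₂_eq_zero hg₂ hz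
  have h3 := derivWeierstrassP_sq_of_g₂_eq_zero hg₂ hg₃ hz
  have h := (((h1.const_mul 2).fun_inv (mul_ne_zero two_ne_zero h0)).const_mul 1).fun_mul
    ((h2.const_mul ((√3 : ℝ) : ℂ)⁻¹).const_add 1)
  simp only [← div_eq_mul_inv] at h
  refine h.congr_deriv ?_
  have hk := ofReal_sqrt_three_sq
  have hk0 := ofReal_sqrt_three_ne_zero
  rw [bakerF]
  generalize ((√3 : ℝ) : ℂ) = κ at *
  field_simp
  linear_combination (-3) * h3 - hk

/-- Each choice of the sign of `℘'` occurs on a fibre of `℘`. -/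
theorem exists_weierstrassP_eq_and_derivWeierstrassP_eq (hg₂ : L.g₂ = 0) (hg₃ : L.g₃ = 1)
    {x y : ℂ} (h : y ^ 2 = 4 * x ^ 3 - 1) :
    ∃ z, z ∉ L.lattice ∧ L.weierstrassP z = x ∧ L.derivWeierstrassP z = y := by
  obtain ⟨z, hz, hx⟩ := L.exists_weierstrassP_eq x
  have h1 := derivWeierstrassP_sq_of_g₂_eq_zero hg₂ hg₃ hz
  rw [hx, ← h] at h1
  rcases sq_eq_sq_iff_eq_or_eq_neg.1 h1 with h2 | h2
  · exact ⟨z, hz, hx, h2⟩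
  · refine ⟨-z, fun hn => hz (by simpa using L.lattice.neg_mem hn), ?_, ?_⟩
    · rw [L.weierstrassP_neg, hx]
    · rw [L.derivWeierstrassP_neg, h2, neg_neg]

/-- Solving for ℘ and ℘' gives ℘ = 1/(x + y) and ℘' = √3 (y - x)/(x + y); the denominator is nonzero
because it divides x³ + y³ = 1. -/
theorem exists_baker_eq (hg₂ : L.g₂ = 0) (hg₃ : L.g₃ = 1) {x y : ℂ} (h : x ^ 3 + y ^ 3 = 1) :
    ∃ z, z ∉ L.lattice ∧ L.weierstrassP z ≠ 0 ∧ bakerF L z = x ∧ bakerG L z = y := by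
  have hxy : x + y ≠ 0 := fun h0 => by
    have : x ^ 3 + y ^ 3 = 0 := by linear_combination (x ^ 2 - x * y + y ^ 2) * h0
    rw [h] at this
    exact one_ne_zero this
  have hk := ofReal_sqrt_three_sq
  have hk0 := ofReal_sqrt_three_ne_zero
  obtain ⟨z, hz, h1, h2⟩ := exists_weierstrassP_eq_and_derivWeierstrassP_eq hg₂ hg₃
    (x := (x + y)⁻¹) (y := ((√3 : ℝ) : ℂ) * (y - x) / (x + y)) (by
      rw [div_pow, mul_pow, hk]
      field_simp
      linear_combination 4 * h)
  refine ⟨z, hz, by rw [h1]; exact inv_ne_zero hxy, ?_, ?_⟩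
  · rw [bakerF, h1, h2]
    field_simp
    ring
  · rw [bakerG, h1, h2]
    field_simp
    ring

end Baker

/-! ### The Wronskian of a meromorphic solution. -/

/-- If `F³ + G³ = 1`, then `F G' - F' G` has no poles. -/
theorem meromorphicOrderAt_wronskian_nonneg {F G : ℂ → ℂ} {z₀ : ℂ} (hF : MeromorphicAt F z₀)
    (hG : MeromorphicAt G z₀) (h : ∀ᶠ z in 𝓝[≠] z₀, F z ^ 3 + G z ^ 3 = 1) :
    0 ≤ meromorphicOrderAt (fun z => F z * deriv G z - deriv F z * G z) z₀ := by
  have hW : MeromorphicAt (fun z => F z * deriv G z - deriv F z * G z) z₀ := by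
    have := hF.deriv
    have := hG.deriv
    fun_prop
  have hderiv : ∀ {f g : ℂ → ℂ}, f =ᶠ[𝓝[≠] z₀] g → deriv f =ᶠ[𝓝[≠] z₀] deriv g := by
    intro f g hfg
    filter_upwards [eventually_eventually_nhdsWithin.2 hfg, self_mem_nhdsWithin] with z hz hne
    rw [isOpen_compl_singleton.nhdsWithin_eq hne] at hz
    exact EventuallyEq.deriv_eq hz
  rw [hW.meromorphicOrderAt_nonneg_iff]
  rcases le_or_gt 0 (meromorphicOrderAt F z₀) with hF0 | hF0
  · have hG0 : 0 ≤ meromorphicOrderAt G z₀ := by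
      by_contra! hneg
      obtain ⟨f, hf, hFf⟩ := hF.meromorphicOrderAt_nonneg_iff.1 hF0
      have h3 : (fun z => G z ^ 3) =ᶠ[𝓝[≠] z₀] fun z => 1 - f z ^ 3 := by
        filter_upwards [h, hFf] with z h1 h2
        rw [← h2]
        linear_combination h1
      have h4 : 0 ≤ meromorphicOrderAt (fun z => G z ^ 3) z₀ := by
        rw [meromorphicOrderAt_congr h3]
        exact AnalyticAt.meromorphicOrderAt_nonneg (by fun_prop)
      have h5 := tendsto_cobounded_of_meromorphicOrderAt_neg hneg
      have h6 : Tendsto (fun z => ‖G z ^ 3‖) (𝓝[≠] z₀) atTop := by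
        simp only [norm_pow]
        exact (tendsto_pow_atTop three_ne_zero).comp (tendsto_norm_cobounded_atTop.comp h5)
      obtain ⟨c, hc⟩ := tendsto_nhds_of_meromorphicOrderAt_nonneg (hG.fun_pow 3) h4
      exact not_tendsto_nhds_of_tendsto_atTop h6 _ hc.norm
    obtain ⟨f, hf, hFf⟩ := hF.meromorphicOrderAt_nonneg_iff.1 hF0
    obtain ⟨g, hg, hGg⟩ := hG.meromorphicOrderAt_nonneg_iff.1 hG0
    refine ⟨fun z => f z * deriv g z - deriv f z * g z, ?_, ?_⟩
    · have := hf.deriv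
      have := hg.deriv
      fun_prop
    · filter_upwards [hFf, hGg, hderiv hFf, hderiv hGg] with z h1 h2 h3 h4
      rw [h1, h2, h3, h4]
  -- At a pole of F let p, q extend 1/F and G/F. Then q³ = p³ - 1, so q²q' = p²p', and W = F²(G/F)'
  -- = q'/p² = p'/q². This is analytic because q(z₀)³ = -1.
  · have hFcob := tendsto_cobounded_of_meromorphicOrderAt_neg hF0
    have hF1 : ∀ᶠ z in 𝓝[≠] z₀, F z ≠ 0 := by
      have := tendsto_norm_cobounded_atTop.comp hFcob
      filter_upwards [this.eventually_gt_atTop 0] with z hz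
      exact norm_pos_iff.1 hz
    have hp0 : 0 ≤ meromorphicOrderAt F⁻¹ z₀ := by
      rw [← tendsto_nhds_iff_meromorphicOrderAt_nonneg hF.inv]
      exact ⟨0, tendsto_inv₀_cobounded.comp hFcob⟩
    obtain ⟨p, hp, hFp⟩ := hF.inv.meromorphicOrderAt_nonneg_iff.1 hp0
    have hpz : p z₀ = 0 := by
      have h1 : Tendsto p (𝓝[≠] z₀) (𝓝 (p z₀)) := hp.continuousAt.mono_left nhdsWithin_le_nhds
      exact tendsto_nhds_unique h1 ((tendsto_inv₀_cobounded.comp hFcob).congr' hFp)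
    have hq : MeromorphicAt (fun z => G z / F z) z₀ := hG.fun_div hF
    have hq3 : ∀ᶠ z in 𝓝[≠] z₀, (G z / F z) ^ 3 = p z ^ 3 - 1 := by
      filter_upwards [h, hFp, hF1] with z h1 h2 h3
      rw [← h2, Pi.inv_apply]
      field_simp
      linear_combination h1
    have hq0 : 0 ≤ meromorphicOrderAt (fun z => G z / F z) z₀ := by
      by_contra! hneg
      have h5 := tendsto_cobounded_of_meromorphicOrderAt_neg hneg
      have h6 : Tendsto (fun z => ‖(G z / F z) ^ 3‖) (𝓝[≠] z₀) atTop := by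
        simp only [norm_pow]
        exact (tendsto_pow_atTop three_ne_zero).comp (tendsto_norm_cobounded_atTop.comp h5)
      have h7 : Tendsto (fun z => p z ^ 3 - 1) (𝓝[≠] z₀) (𝓝 (p z₀ ^ 3 - 1)) :=
        ((hp.continuousAt.pow 3).sub_const 1).mono_left nhdsWithin_le_nhds
      exact not_tendsto_nhds_of_tendsto_atTop h6 _ (h7.congr' (hq3.mono fun _ h => h.symm)).norm
    obtain ⟨q, hqa, hGq⟩ := hq.meromorphicOrderAt_nonneg_iff.1 hq0
    have hqp : ∀ᶠ z in 𝓝[≠] z₀, q z ^ 3 = p z ^ 3 - 1 := by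
      filter_upwards [hq3, hGq] with z h1 h2
      rw [← h2, h1]
    have hqz : q z₀ ≠ 0 := by
      have h1 : q z₀ ^ 3 = p z₀ ^ 3 - 1 :=
        tendsto_nhds_unique_of_eventuallyEq
          ((hqa.continuousAt.pow 3).mono_left nhdsWithin_le_nhds)
          (((hp.continuousAt.pow 3).sub_const 1).mono_left nhdsWithin_le_nhds) hqp
      intro h0
      rw [h0, hpz] at h1
      norm_num at h1
    refine ⟨fun z => deriv p z / q z ^ 2, ?_, ?_⟩
    · have := hp.deriv
      exact this.fun_div (hqa.pow 2) (pow_ne_zero 2 hqz)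
    · have hFp' : F =ᶠ[𝓝[≠] z₀] fun z => (p z)⁻¹ := hFp.mono fun z hz => by
        simp [← hz]
      have hGp' : G =ᶠ[𝓝[≠] z₀] fun z => q z * (p z)⁻¹ := by
        filter_upwards [hGq, hFp', hF1] with z h1 h2 h3
        rw [← h1, ← h2]
        field_simp
      filter_upwards [hFp', hGp', hderiv hFp', hderiv hGp', hF1,
        hp.eventually_analyticAt.filter_mono nhdsWithin_le_nhds,
        hqa.eventually_analyticAt.filter_mono nhdsWithin_le_nhds,
        (hqa.continuousAt.eventually_ne hqz).filter_mono nhdsWithin_le_nhds,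
        hderiv hqp] with z h1 h2 h3 h4 h5 h6 h7 h8 h9
      have hp1 : p z ≠ 0 := fun h0 => h5 (by rw [h1, h0, inv_zero])
      have dp := h6.differentiableAt.hasDerivAt
      have dq := h7.differentiableAt.hasDerivAt
      rw [(dq.fun_pow 3).deriv, ((dp.fun_pow 3).sub_const 1).deriv] at h9
      rw [h1, h2, h3, h4, (dp.fun_inv hp1).deriv, (dq.fun_mul (dp.fun_inv hp1)).deriv]
      field_simp
      push_cast at h9
      linear_combination p z / 3 * h9

/-! ### Factoring meromorphic solutions through the parametrisation. -/

theorem eventually_nhds_of_eventually_nhdsNE {X : Type*} [TopologicalSpace X] [T1Space X] {x : X}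
    {P : X → Prop} (h : ∀ᶠ y in 𝓝[≠] x, P y) : ∀ᶠ y in 𝓝[≠] x, ∀ᶠ z in 𝓝 y, P z := by
  filter_upwards [eventually_eventually_nhdsWithin.2 h, self_mem_nhdsWithin] with z hz hne
  rwa [isOpen_compl_singleton.nhdsWithin_eq hne] at hz

theorem eventually_codiscrete_iff {X : Type*} [TopologicalSpace X] {P : X → Prop} :
    (∀ᶠ x in codiscrete X, P x) ↔ ∀ x, ∀ᶠ y in 𝓝[≠] x, P y := by
  simp only [Filter.Eventually, mem_codiscrete, disjoint_principal_right, compl_compl]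

/-- The identity theorem for meromorphic functions on the complex plane. -/
theorem Meromorphic.eventuallyEq_codiscrete {f g : ℂ → ℂ} (hf : Meromorphic f)
    (hg : Meromorphic g) {z₀ : ℂ} (h : f =ᶠ[𝓝 z₀] g) : f =ᶠ[codiscrete ℂ] g := by
  have hd : Meromorphic (fun z => f z - g z) := hf.fun_sub hg
  have h0 : meromorphicOrderAt (fun z => f z - g z) z₀ = ⊤ :=
    meromorphicOrderAt_eq_top_iff.2 ((h.filter_mono nhdsWithin_le_nhds).mono fun z hz =>
      sub_eq_zero.2 hz)
  refine eventually_codiscrete_iff.2 fun x => ?_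
  have hx : meromorphicOrderAt (fun z => f z - g z) x = ⊤ := by
    by_contra hne
    exact hd.meromorphicOn.meromorphicOrderAt_ne_top_of_isPreconnected isPreconnected_univ
      (mem_univ x) (mem_univ z₀) hne h0
  exact (meromorphicOrderAt_eq_top_iff.1 hx).mono fun z hz => sub_eq_zero.1 hz

/-- Two solutions of `f' = -g² a`, `g' = f² a` with the same initial value coincide. -/
theorem eventuallyEq_of_hasDerivAt_sq {a f g f₁ g₁ : ℂ → ℂ} {z₀ : ℂ} (ha : ContinuousAt a z₀)
    (hf : ∀ᶠ z in 𝓝 z₀, HasDerivAt f (-g z ^ 2 * a z) z)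
    (hg : ∀ᶠ z in 𝓝 z₀, HasDerivAt g (f z ^ 2 * a z) z)
    (hf₁ : ∀ᶠ z in 𝓝 z₀, HasDerivAt f₁ (-g₁ z ^ 2 * a z) z)
    (hg₁ : ∀ᶠ z in 𝓝 z₀, HasDerivAt g₁ (f₁ z ^ 2 * a z) z)
    (hf0 : f z₀ = f₁ z₀) (hg0 : g z₀ = g₁ z₀) : f =ᶠ[𝓝 z₀] f₁ ∧ g =ᶠ[𝓝 z₀] g₁ := by
  have hbound : ∀ {u : ℂ → ℂ}, ContinuousAt u z₀ → ∃ M, ∀ᶠ z in 𝓝 z₀, ‖u z‖ ≤ M := fun hu =>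
    ⟨_, (hu.norm.eventually (gt_mem_nhds (lt_add_one _))).mono fun _ h => h.le⟩
  have cf := hf.self_of_nhds.continuousAt
  have cg := hg.self_of_nhds.continuousAt
  have cf₁ := hf₁.self_of_nhds.continuousAt
  have cg₁ := hg₁.self_of_nhds.continuousAt
  obtain ⟨M, hM⟩ := hbound ((cg.add cg₁).mul ha)
  obtain ⟨N, hN⟩ := hbound ((cf.add cf₁).mul ha)
  have key : ∀ᶠ z in 𝓝 z₀, ((f z - f₁ z, g z - g₁ z) : ℂ × ℂ) = 0 := by
    refine eventually_eq_zero_of_norm_deriv_le (K := max M N)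
      (d' := fun z => (-g z ^ 2 * a z - -g₁ z ^ 2 * a z, f z ^ 2 * a z - f₁ z ^ 2 * a z)) ?_ ?_
      (by simp [hf0, hg0])
    · filter_upwards [hf, hg, hf₁, hg₁] with z h1 h2 h3 h4
      exact (h1.sub h3).prodMk (h2.sub h4)
    · filter_upwards [hM, hN] with z h1 h2
      have hfst := norm_fst_le (f z - f₁ z, g z - g₁ z)
      have hsnd := norm_snd_le (f z - f₁ z, g z - g₁ z)
      have h0 := (norm_nonneg _).trans h1
      refine max_le ?_ ?_
      · have : -g z ^ 2 * a z - -g₁ z ^ 2 * a z = -((g z + g₁ z) * a z * (g z - g₁ z)) := by ring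
        rw [this, norm_neg, norm_mul]
        exact mul_le_mul (h1.trans (le_max_left _ _)) hsnd (norm_nonneg _)
          (h0.trans (le_max_left _ _))
      · have : f z ^ 2 * a z - f₁ z ^ 2 * a z = (f z + f₁ z) * a z * (f z - f₁ z) := by ring
        rw [this, norm_mul]
        exact mul_le_mul (h2.trans (le_max_right _ _)) hfst (norm_nonneg _)
          (h0.trans (le_max_left _ _))
  exact ⟨key.mono fun z hz => sub_eq_zero.1 (congrArg Prod.fst hz),
    key.mono fun z hz => sub_eq_zero.1 (congrArg Prod.snd hz)⟩

/-- Meromorphic solutions of `F³ + G³ = 1` factor through the Weierstrass parametrisation. -/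
theorem exists_entire_of_cube_add_cube_eq_one {L : PeriodPair} (hg₂ : L.g₂ = 0) (hg₃ : L.g₃ = 1)
    {F G : ℂ → ℂ} (hF : Meromorphic F) (hG : Meromorphic G)
    (h : (fun z => F z ^ 3 + G z ^ 3) =ᶠ[codiscrete ℂ] (fun _ => 1)) :
    ∃ α : ℂ → ℂ, Differentiable ℂ α ∧ F =ᶠ[codiscrete ℂ] (fun z => bakerF L (α z)) ∧
      G =ᶠ[codiscrete ℂ] (fun z => bakerG L (α z)) := by
  have h := eventually_codiscrete_iff.1 h
  set κ : ℂ := ((√3 : ℝ) : ℂ)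
  have hκ : κ ≠ 0 := ofReal_sqrt_three_ne_zero
  set W : ℂ → ℂ := fun z => F z * deriv G z - deriv F z * G z
  have hW : MeromorphicOn W univ := by
    have := hF.deriv
    have := hG.deriv
    intro z _
    have hWm : Meromorphic W := by fun_prop
    exact hWm z
  -- The normal form fills in the removable singularities of W, making it entire.
  set a : ℂ → ℂ := toMeromorphicNFOn W univ
  have ha : ∀ z, AnalyticAt ℂ a z := fun z => by
    refine (meromorphicNFOn_toMeromorphicNFOn W univ (mem_univ z)
      ).meromorphicOrderAt_nonneg_iff_analyticAt.1 ?_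
    rw [meromorphicOrderAt_toMeromorphicNFOn hW (mem_univ z)]
    exact meromorphicOrderAt_wronskian_nonneg (hF z) (hG z) (h z)
  -- The point 0 may be exceptional, but all nearby points are good.
  obtain ⟨z₀, hFa, hGa, hone, haW⟩ : ∃ z₀, AnalyticAt ℂ F z₀ ∧ AnalyticAt ℂ G z₀ ∧
      (∀ᶠ z in 𝓝 z₀, F z ^ 3 + G z ^ 3 = 1) ∧ (∀ᶠ z in 𝓝 z₀, a z = W z) :=
    ((hF 0).eventually_analyticAt.and ((hG 0).eventually_analyticAt.and
      ((eventually_nhds_of_eventually_nhdsNE (h 0)).and (eventually_nhds_of_eventually_nhdsNE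
        (hW.toMeromorphicNFOn_eq_self_on_nhdsNE (mem_univ 0)))))).exists
  obtain ⟨c, hc, hc0, hcF, hcG⟩ := exists_baker_eq hg₂ hg₃ hone.self_of_nhds
  -- The system for f ∘ α has coefficient √3 α', which must equal W.
  obtain ⟨α, hα0, hα⟩ := (Differentiable.isExactOn_univ
    (f := fun z => a z / κ) fun z => (ha z).differentiableAt.div_const κ).with_val_at z₀ c
  have hαd : Differentiable ℂ α := fun z => (hα z (mem_univ z)).differentiableAt
  have hFG : ∀ᶠ z in 𝓝 z₀, HasDerivAt F (-G z ^ 2 * a z) z ∧ HasDerivAt G (F z ^ 2 * a z) z := by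
    filter_upwards [hone.eventually_nhds, haW, hFa.eventually_analyticAt,
      hGa.eventually_analyticAt] with z h1 h2 h3 h4
    have d1 := h3.differentiableAt.hasDerivAt
    have d2 := h4.differentiableAt.hasDerivAt
    have e := ((d1.fun_pow 3).fun_add (d2.fun_pow 3)).unique
      ((hasDerivAt_const z (1 : ℂ)).congr_of_eventuallyEq h1)
    have h1z := h1.self_of_nhds
    push_cast at e
    refine ⟨d1.congr_deriv ?_, d2.congr_deriv ?_⟩
    · rw [h2]
      linear_combination (-deriv F z) * h1z + F z / 3 * e
    · rw [h2]
      linear_combination (-deriv G z) * h1z + G z / 3 * e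
  have hoff : ∀ᶠ z in 𝓝 z₀, α z ∉ L.lattice ∧ L.weierstrassP (α z) ≠ 0 := by
    have hT : Tendsto α (𝓝 z₀) (𝓝 c) := hα0 ▸ (hαd z₀).continuousAt
    exact hT.eventually ((L.eventually_notMem_lattice hc).and
      ((L.hasDerivAt_weierstrassP hc).continuousAt.eventually_ne hc0))
  have key := eventuallyEq_of_hasDerivAt_sq (f₁ := fun z => bakerF L (α z))
    (g₁ := fun z => bakerG L (α z)) (ha z₀).continuousAt (hFG.mono fun _ h => h.1)
    (hFG.mono fun _ h => h.2) (by
      filter_upwards [hoff] with z hz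
      refine ((hasDerivAt_bakerF hg₂ hg₃ hz.1 hz.2).comp z (hα z (mem_univ z))).congr_deriv ?_
      change -κ * bakerG L (α z) ^ 2 * (a z / κ) = _
      field_simp) (by
      filter_upwards [hoff] with z hz
      refine ((hasDerivAt_bakerG hg₂ hg₃ hz.1 hz.2).comp z (hα z (mem_univ z))).congr_deriv ?_
      change κ * bakerF L (α z) ^ 2 * (a z / κ) = _
      field_simp) (by rw [hα0, hcF]) (by rw [hα0, hcG])
  exact ⟨α, hαd,
    hF.eventuallyEq_codiscrete (fun z => (meromorphic_bakerF _).comp_analyticAt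
      (hαd.analyticAt z)) key.1,
    hG.eventuallyEq_codiscrete (fun z => (meromorphic_bakerG _).comp_analyticAt
      (hαd.analyticAt z)) key.2⟩

/-! ### Homogeneous coordinates of the parametrisation. -/

open scoped Classical in
/-- Homogeneous coordinates of the Weierstrass parametrisation of the Fermat cubic. -/
def bakerVec (L : PeriodPair) (z : ℂ) : Fin 3 → ℂ :=
  -- At a lattice point ℘' dominates 1 and ℘, so the generic point tends to [-1 : 1 : 0].
  if z ∈ L.lattice then ![1, -1, 0] else
    ![1 - ((√3 : ℝ) : ℂ)⁻¹ * L.derivWeierstrassP z, 1 + ((√3 : ℝ) : ℂ)⁻¹ * L.derivWeierstrassP z,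
      2 * L.weierstrassP z]

section BakerVec

variable {L : PeriodPair}

theorem bakerVec_of_mem {z : ℂ} (hz : z ∈ L.lattice) : bakerVec L z = ![1, -1, 0] := if_pos hz

theorem bakerVec_of_notMem {z : ℂ} (hz : z ∉ L.lattice) : bakerVec L z =
    ![1 - ((√3 : ℝ) : ℂ)⁻¹ * L.derivWeierstrassP z, 1 + ((√3 : ℝ) : ℂ)⁻¹ * L.derivWeierstrassP z,
      2 * L.weierstrassP z] := if_neg hz

/-- The form x + y detects the lattice points and, off the lattice, fixes the scaling: proportional
vectors are then equal. -/
theorem bakerVec_zero_add_one_of_mem {z : ℂ} (hz : z ∈ L.lattice) :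
    bakerVec L z 0 + bakerVec L z 1 = 0 := by
  simp [bakerVec_of_mem hz]

theorem bakerVec_zero_add_one_of_notMem {z : ℂ} (hz : z ∉ L.lattice) :
    bakerVec L z 0 + bakerVec L z 1 = 2 := by
  simp only [bakerVec_of_notMem hz, Matrix.cons_val]
  ring

theorem bakerVec_ne_zero (L : PeriodPair) (z : ℂ) : bakerVec L z ≠ 0 := by
  intro h
  by_cases hz : z ∈ L.lattice
  · have := congrFun h 0
    simp [bakerVec_of_mem hz] at this
  · have := bakerVec_zero_add_one_of_notMem hz
    simp [h] at this

theorem bakerVec_eqn (hg₂ : L.g₂ = 0) (hg₃ : L.g₃ = 1) (z : ℂ) :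
    bakerVec L z 0 ^ 3 + bakerVec L z 1 ^ 3 = bakerVec L z 2 ^ 3 := by
  by_cases hz : z ∈ L.lattice
  · simp [bakerVec_of_mem hz]
    norm_num
  · have h3 := derivWeierstrassP_sq_of_g₂_eq_zero hg₂ hg₃ hz
    have hk := ofReal_sqrt_three_sq
    have hk0 := ofReal_sqrt_three_ne_zero
    simp only [bakerVec_of_notMem hz, Matrix.cons_val]
    generalize ((√3 : ℝ) : ℂ) = κ at *
    have hk' : κ⁻¹ ^ 2 = 3⁻¹ := by rw [inv_pow, hk]
    linear_combination 6 * L.derivWeierstrassP z ^ 2 * hk' + 2 * h3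

theorem bakerVec_add (z : ℂ) {l : ℂ} (hl : l ∈ L.lattice) : bakerVec L (z + l) = bakerVec L z := by
  have h : z + l ∈ L.lattice ↔ z ∈ L.lattice := L.lattice.add_mem_iff_left hl
  by_cases hz : z ∈ L.lattice
  · rw [bakerVec_of_mem hz, bakerVec_of_mem (h.2 hz)]
  · rw [bakerVec_of_notMem hz, bakerVec_of_notMem (mt h.1 hz), L.weierstrassP_add_coe z ⟨l, hl⟩,
      L.derivWeierstrassP_add_coe z ⟨l, hl⟩]

theorem sub_mem_lattice_of_bakerVec {z w a : ℂ} (h : a • bakerVec L w = bakerVec L z) :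
    z - w ∈ L.lattice := by
  have hm : ∀ m, a * bakerVec L w m = bakerVec L z m := fun m => congrFun h m
  have ha : a ≠ 0 := by
    rintro rfl
    exact bakerVec_ne_zero L z (by rw [← h, zero_smul])
  have hs : a * (bakerVec L w 0 + bakerVec L w 1) = bakerVec L z 0 + bakerVec L z 1 := by
    rw [mul_add, hm, hm]
  by_cases hz : z ∈ L.lattice
  · by_cases hw : w ∈ L.lattice
    · exact L.lattice.sub_mem hz hw
    · rw [bakerVec_zero_add_one_of_mem hz, bakerVec_zero_add_one_of_notMem hw] at hs
      simp [ha] at hs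
  · by_cases hw : w ∈ L.lattice
    · rw [bakerVec_zero_add_one_of_notMem hz, bakerVec_zero_add_one_of_mem hw] at hs
      simp at hs
    · rw [bakerVec_zero_add_one_of_notMem hz, bakerVec_zero_add_one_of_notMem hw] at hs
      have ha1 : a = 1 := by linear_combination hs / 2
      have h1 := hm 1
      have h2 := hm 2
      simp only [bakerVec_of_notMem hz, bakerVec_of_notMem hw, ha1, Matrix.cons_val] at h1 h2
      refine L.sub_mem_lattice_of_eq hz hw (by linear_combination (-1 / 2) * h2) ?_
      have hk := ofReal_sqrt_three_ne_zero
      field_simp at h1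
      linear_combination -h1

/-- The line x + y = 0 meets the cubic only at [1 : -1 : 0]. Elsewhere, scaling to x + y = 2 lets ℘
and ℘' be read off. -/
theorem exists_smul_bakerVec (hg₂ : L.g₂ = 0) (hg₃ : L.g₃ = 1) {v : Fin 3 → ℂ}
    (h : v 0 ^ 3 + v 1 ^ 3 = v 2 ^ 3) : ∃ (z a : ℂ), a • bakerVec L z = v := by
  by_cases hs : v 0 + v 1 = 0
  · have h2 : v 2 = 0 := by
      refine pow_eq_zero_iff three_ne_zero |>.1 ?_
      linear_combination -h + (v 0 ^ 2 - v 0 * v 1 + v 1 ^ 2) * hs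
    refine ⟨0, v 0, ?_⟩
    rw [bakerVec_of_mem L.lattice.zero_mem]
    funext m
    fin_cases m
    · simp
    · simp
      linear_combination -hs
    · simp [h2]
  · have hk := ofReal_sqrt_three_sq
    have hk0 := ofReal_sqrt_three_ne_zero
    obtain ⟨z, hz, h1, h2⟩ := exists_weierstrassP_eq_and_derivWeierstrassP_eq hg₂ hg₃
      (x := v 2 / (v 0 + v 1)) (y := ((√3 : ℝ) : ℂ) * (v 1 - v 0) / (v 0 + v 1)) (by
        rw [div_pow, mul_pow, hk, div_pow, ← h]
        field_simp
        ring)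
    refine ⟨z, (v 0 + v 1) / 2, ?_⟩
    rw [bakerVec_of_notMem hz, h1, h2]
    funext m
    fin_cases m
    · simp
      field_simp
      ring
    · simp
      field_simp
      ring
    · simp
      field_simp

/-- The components of the cross product of `u` and `u'` are multiples of the partial derivatives of
`x³ + y³ - z³` at `u`. -/
def IsCubicTangent (u u' : Fin 3 → ℂ) : Prop :=
  ∃ c ≠ 0, u' 0 * u 1 - u 0 * u' 1 = c * u 2 ^ 2 ∧ u' 0 * u 2 - u 0 * u' 2 = c * u 1 ^ 2 ∧
    u' 1 * u 2 - u 1 * u' 2 = -c * u 0 ^ 2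

/-- The minor is the numerator of the derivative of u (σ 0) / u (σ 2), which is a chart coordinate;
up to sign it is c u (σ 1)². -/
theorem IsCubicTangent.ne_zero {u u' : Fin 3 → ℂ} (h : IsCubicTangent u u')
    (σ : Equiv.Perm (Fin 3)) (h1 : u (σ 1) ≠ 0) :
    u' (σ 0) * u (σ 2) - u (σ 0) * u' (σ 2) ≠ 0 := by
  obtain ⟨c, hc, e2, e1, e0⟩ := h
  have h01 : σ 0 ≠ σ 1 := σ.injective.ne (by decide)
  have h02 : σ 0 ≠ σ 2 := σ.injective.ne (by decide)
  have h12 : σ 1 ≠ σ 2 := σ.injective.ne (by decide)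
  have hne : c * u (σ 1) ^ 2 ≠ 0 := mul_ne_zero hc (pow_ne_zero 2 h1)
  generalize σ 0 = i at *
  generalize σ 1 = j at *
  generalize σ 2 = k at *
  intro h0
  apply hne
  fin_cases i <;> fin_cases j <;> fin_cases k <;>
    first
    | exact absurd rfl h01
    | exact absurd rfl h02
    | exact absurd rfl h12
    | skip
  all_goals simp only [Fin.zero_eta, Fin.mk_one, Fin.reduceFinMk] at h0 ⊢
  · linear_combination h0 - e1
  · linear_combination h0 - e2
  · linear_combination e0 - h0
  · linear_combination -h0 - e2
  · linear_combination e0 + h0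
  · linear_combination -h0 - e1

/-- Near every point there are holomorphic homogeneous coordinates of the parametrisation. -/
theorem exists_analyticAt_lift (hg₂ : L.g₂ = 0) (hg₃ : L.g₃ = 1) (z₀ : ℂ) :
    ∃ u : Fin 3 → ℂ → ℂ, (∀ m, AnalyticAt ℂ (u m) z₀) ∧
      (∀ᶠ z in 𝓝 z₀, ∃ a : ℂ, a ≠ 0 ∧ (fun m => u m z) = a • bakerVec L z) ∧
      IsCubicTangent (fun m => u m z₀) (fun m => deriv (u m) z₀) := by
  have hk := ofReal_sqrt_three_sq
  have hk0 := ofReal_sqrt_three_ne_zero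
  by_cases hz : z₀ ∈ L.lattice
  · set l : L.lattice := ⟨z₀, hz⟩
    have hE : AnalyticAt ℂ (L.weierstrassPExcept z₀) z₀ := by fun_prop
    have hE' : AnalyticAt ℂ (L.derivWeierstrassPExcept z₀) z₀ :=
      L.analyticAt_derivWeierstrassPExcept z₀
    have hcube : ∀ {f : ℂ → ℂ}, AnalyticAt ℂ f z₀ →
        HasDerivAt (fun z => (z - z₀) ^ 3 * f z) 0 z₀ := fun {f} hf => by
      have := (((hasDerivAt_id z₀).sub_const z₀).fun_pow 3).fun_mul
        hf.differentiableAt.hasDerivAt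
      simpa using this
    -- The factor (z - z₀)³ clears the pole -2/(z - z₀)³ of ℘'. In `w`, the term 1 / z₀ ^ 2 comes
    -- from the lattice sum; for z₀ = 0 it is 0 by the convention on division, as it should be.
    set x : ℂ → ℂ := fun z => (z - z₀) ^ 3 * (1 - ((√3 : ℝ) : ℂ)⁻¹ * L.derivWeierstrassPExcept z₀ z)
      + 2 * ((√3 : ℝ) : ℂ)⁻¹
    set y : ℂ → ℂ := fun z => (z - z₀) ^ 3 * (1 + ((√3 : ℝ) : ℂ)⁻¹ * L.derivWeierstrassPExcept z₀ z)
      - 2 * ((√3 : ℝ) : ℂ)⁻¹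
    set w : ℂ → ℂ := fun z => (z - z₀) ^ 3 * (2 * (L.weierstrassPExcept z₀ z - 1 / z₀ ^ 2))
      + 2 * (z - z₀)
    have hx : AnalyticAt ℂ x z₀ := by fun_prop
    have hy : AnalyticAt ℂ y z₀ := by fun_prop
    have hw : AnalyticAt ℂ w z₀ := by fun_prop
    have hx' : HasDerivAt x 0 z₀ := (hcube (by fun_prop)).add_const _
    have hy' : HasDerivAt y 0 z₀ := (hcube (by fun_prop)).sub_const _
    have hw' : HasDerivAt w 2 z₀ := by
      have := (hcube (f := fun z => 2 * (L.weierstrassPExcept z₀ z - 1 / z₀ ^ 2))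
        (by fun_prop)).fun_add (((hasDerivAt_id z₀).sub_const z₀).const_mul 2)
      simpa [w] using this
    -- The constant -√3 is that of f' = -√3 g². Rescaling a lift by a holomorphic factor multiplies
    -- both sides of the tangency identities by its square, so the constant does not change.
    refine ⟨![x, y, w], ?_, ?_, -((√3 : ℝ) : ℂ), neg_ne_zero.2 hk0, ?_⟩
    · intro m
      fin_cases m
      exacts [hx, hy, hw]
    · filter_upwards [L.compl_lattice_sdiff_singleton_mem_nhds z₀] with z hzn
      by_cases hzz : z = z₀
      · refine ⟨2 * ((√3 : ℝ) : ℂ)⁻¹, mul_ne_zero two_ne_zero (inv_ne_zero hk0), ?_⟩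
        rw [hzz, bakerVec_of_mem hz]
        funext m
        fin_cases m <;> simp [x, y, w]
      · have hzL : z ∉ L.lattice := fun h => hzn ⟨h, hzz⟩
        have ht : z - z₀ ≠ 0 := sub_ne_zero.2 hzz
        refine ⟨(z - z₀) ^ 3, pow_ne_zero 3 ht, ?_⟩
        rw [bakerVec_of_notMem hzL]
        have e1 := L.weierstrassPExcept_add l z
        have e2 := L.derivWeierstrassPExcept_sub l z
        have hl : (l : ℂ) = z₀ := rfl
        rw [hl] at e1 e2
        rw [← e1, ← e2]
        funext m
        fin_cases m
        · simp [x]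
          field_simp
          ring
        · simp [y]
          field_simp
          ring
        · simp [w]
          generalize (z₀ ^ 2)⁻¹ = b
          field_simp
          ring
    · simp only [Matrix.cons_val, hx'.deriv, hy'.deriv, hw'.deriv]
      simp only [x, y, w, sub_self]
      refine ⟨by ring, ?_, ?_⟩
      · field_simp
        norm_num
      · field_simp
        norm_num
  · have h1 := L.hasDerivAt_weierstrassP hz
    have h2 := hasDerivAt_derivWeierstrassP_of_g₂_eq_zero hg₂ hz
    have h3 := derivWeierstrassP_sq_of_g₂_eq_zero hg₂ hg₃ hz
    have a1 := L.analyticOnNhd_weierstrassP z₀ hz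
    have a2 := L.analyticOnNhd_derivWeierstrassP z₀ hz
    refine ⟨![fun z => 1 - ((√3 : ℝ) : ℂ)⁻¹ * L.derivWeierstrassP z,
      fun z => 1 + ((√3 : ℝ) : ℂ)⁻¹ * L.derivWeierstrassP z, fun z => 2 * L.weierstrassP z],
      ?_, ?_, -((√3 : ℝ) : ℂ), neg_ne_zero.2 hk0, ?_⟩
    · intro m
      fin_cases m
      · exact analyticAt_const.fun_sub (analyticAt_const.fun_mul a2)
      · exact analyticAt_const.fun_add (analyticAt_const.fun_mul a2)
      · exact analyticAt_const.fun_mul a1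
    · filter_upwards [L.eventually_notMem_lattice hz] with z hzL
      refine ⟨1, one_ne_zero, ?_⟩
      rw [bakerVec_of_notMem hzL, one_smul]
      funext m
      fin_cases m <;> rfl
    · simp only [Matrix.cons_val, ((h2.const_mul ((√3 : ℝ) : ℂ)⁻¹).const_sub 1).deriv,
        ((h2.const_mul ((√3 : ℝ) : ℂ)⁻¹).const_add 1).deriv, (h1.const_mul 2).deriv]
      generalize ((√3 : ℝ) : ℂ) = κ at *
      refine ⟨?_, ?_, ?_⟩
      · field_simp
        linear_combination 4 * L.weierstrassP z₀ ^ 2 * κ * hk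
      · field_simp
        linear_combination 3 * h3 + hk
      · field_simp
        linear_combination (-3) * h3 - hk

end BakerVec

/-! ### The biholomorphism. -/

section BakerPoint

variable {L : PeriodPair}

/-- The Weierstrass parametrisation of the Fermat cubic. -/
def bakerPoint (hg₂ : L.g₂ = 0) (hg₃ : L.g₃ = 1) (z : ℂ) : FermatCubic :=
  FermatCubic.mk (bakerVec L z) (bakerVec_ne_zero L z) (bakerVec_eqn hg₂ hg₃ z)

theorem toCP2_bakerPoint (hg₂ : L.g₂ = 0) (hg₃ : L.g₃ = 1) (z : ℂ) :
    (bakerPoint hg₂ hg₃ z).toCP2 = Projectivization.mk ℂ (bakerVec L z) (bakerVec_ne_zero L z) :=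
  rfl

theorem bakerPoint_eq_iff (hg₂ : L.g₂ = 0) (hg₃ : L.g₃ = 1) {z w : ℂ} :
    bakerPoint hg₂ hg₃ z = bakerPoint hg₂ hg₃ w ↔ z - w ∈ L.lattice := by
  constructor
  · intro h
    have h1 := congrArg FermatCubic.toCP2 h
    rw [toCP2_bakerPoint, toCP2_bakerPoint, Projectivization.mk_eq_mk_iff'] at h1
    obtain ⟨a, ha⟩ := h1
    exact sub_mem_lattice_of_bakerVec ha
  · intro h
    have h1 := bakerVec_add w h
    rw [add_sub_cancel] at h1
    simp only [bakerPoint, h1]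

theorem bakerPoint_surjective (hg₂ : L.g₂ = 0) (hg₃ : L.g₃ = 1) :
    Function.Surjective (bakerPoint hg₂ hg₃) := by
  intro p
  obtain ⟨z, a, h⟩ := exists_smul_bakerVec hg₂ hg₃ p.rep_eqn
  have ha : a ≠ 0 := by
    rintro rfl
    exact p.toCP2.rep_nonzero (by rw [← h, zero_smul])
  refine ⟨z, Subtype.ext ?_⟩
  change Projectivization.mk ℂ _ _ = p.toCP2
  rw [← Projectivization.mk_rep p.toCP2, Projectivization.mk_eq_mk_iff']
  exact ⟨a⁻¹, by rw [← h, smul_smul, inv_mul_cancel₀ ha, one_smul]⟩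

theorem toCP2_bakerPoint_eq_affine (hg₂ : L.g₂ = 0) (hg₃ : L.g₃ = 1) {z : ℂ}
    (hz : z ∉ L.lattice) (h0 : L.weierstrassP z ≠ 0) :
    (bakerPoint hg₂ hg₃ z).toCP2 = CP2.affine (bakerF L z) (bakerG L z) := by
  rw [toCP2_bakerPoint, CP2.affine, Projectivization.mk_eq_mk_iff']
  refine ⟨2 * L.weierstrassP z, ?_⟩
  rw [bakerVec_of_notMem hz, bakerF, bakerG]
  funext m
  fin_cases m
  · simp
    field_simp
  · simp
    field_simp
  · simp

theorem continuous_bakerPoint (hg₂ : L.g₂ = 0) (hg₃ : L.g₃ = 1) :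
    Continuous (bakerPoint hg₂ hg₃) := by
  classical
  refine continuous_iff_continuousAt.2 fun z₀ => ?_
  obtain ⟨u, hu, hlift, -⟩ := exists_analyticAt_lift hg₂ hg₃ z₀
  have hne : ∀ {z : ℂ} {a : ℂ}, a ≠ 0 ∧ (fun m => u m z) = a • bakerVec L z →
      (fun m => u m z) ≠ 0 := fun h => by
    rw [h.2]
    exact smul_ne_zero h.1 (bakerVec_ne_zero L _)
  -- `bakerVec` jumps at lattice points, so continuity is read off the lift; the second branch only
  -- makes `v` total.
  let v : ℂ → {v : Fin 3 → ℂ // v ≠ 0} := fun z =>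
    if h : (fun m => u m z) ≠ 0 then ⟨fun m => u m z, h⟩ else ⟨bakerVec L z, bakerVec_ne_zero L z⟩
  have hv : ContinuousAt v z₀ := by
    refine Topology.IsInducing.subtypeVal.continuousAt_iff.2 ?_
    have : ContinuousAt (fun z => (fun m => u m z)) z₀ :=
      continuousAt_pi.2 fun m => (hu m).continuousAt
    refine this.congr ?_
    filter_upwards [hlift] with z ⟨a, h⟩
    simp only [Function.comp_apply, v, dif_pos (hne h)]
  refine Topology.IsInducing.subtypeVal.continuousAt_iff.2 ?_
  refine (ContinuousAt.comp (g := Projectivization.mk' ℂ)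
    CP2.isQuotientMap_mk'.continuous.continuousAt hv).congr ?_
  filter_upwards [hlift] with z ⟨a, h⟩
  simp only [Function.comp_apply, v, dif_pos (hne h)]
  change Projectivization.mk ℂ _ _ = Projectivization.mk ℂ _ _
  rw [Projectivization.mk_eq_mk_iff']
  exact ⟨a, h.2.symm⟩

/-- In the charts of the Fermat cubic the parametrisation is holomorphic with nonzero derivative. -/
theorem analyticAt_chart_bakerPoint (hg₂ : L.g₂ = 0) (hg₃ : L.g₃ = 1) {z₀ : ℂ}
    {e : OpenPartialHomeomorph FermatCubic ℂ} (he : e ∈ atlas ℂ FermatCubic)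
    (hz : bakerPoint hg₂ hg₃ z₀ ∈ e.source) :
    AnalyticAt ℂ (e ∘ bakerPoint hg₂ hg₃) z₀ ∧ deriv (e ∘ bakerPoint hg₂ hg₃) z₀ ≠ 0 := by
  obtain ⟨σ, c, hc, rfl⟩ := he
  obtain ⟨u, hu, hlift, htan⟩ := exists_analyticAt_lift hg₂ hg₃ z₀
  obtain ⟨h2, h1⟩ := hz
  have h2 : bakerVec L z₀ (σ 2) ≠ 0 := (CP2.rep_mk_ne_zero (bakerVec_ne_zero L z₀) _).1 h2
  -- The sector in the chart's source excludes 0; this is what makes the minor nonzero.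
  have h1 : bakerVec L z₀ (σ 1) ≠ 0 := by
    intro h0
    apply h1.1
    rw [toCP2_bakerPoint, CP2.ratio_mk, h0, zero_div, zero_div]
  obtain ⟨a, ha, hua⟩ := hlift.self_of_nhds
  have hua : ∀ m, u m z₀ = a * bakerVec L z₀ m := fun m => congrFun hua m
  have hu2 : u (σ 2) z₀ ≠ 0 := by rw [hua]; exact mul_ne_zero ha h2
  have hu1 : u (σ 1) z₀ ≠ 0 := by rw [hua]; exact mul_ne_zero ha h1
  have heq : FermatCubic.chart σ c hc ∘ bakerPoint hg₂ hg₃ =ᶠ[𝓝 z₀]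
      fun z => u (σ 0) z / u (σ 2) z := by
    filter_upwards [hlift] with z ⟨b, hb, h⟩
    have h : ∀ m, u m z = b * bakerVec L z m := fun m => congrFun h m
    refine (CP2.ratio_mk (bakerVec_ne_zero L z) _ _).trans ?_
    rw [h, h, mul_div_mul_left _ _ hb]
  refine ⟨((hu _).fun_div (hu _) hu2).congr heq.symm, ?_⟩
  rw [heq.deriv_eq, deriv_fun_div (hu _).differentiableAt (hu _).differentiableAt hu2]
  exact div_ne_zero (htan.ne_zero σ hu1) (pow_ne_zero 2 hu2)

theorem contMDiff_bakerPoint (hg₂ : L.g₂ = 0) (hg₃ : L.g₃ = 1) :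
    ContMDiff 𝓘(ℂ) 𝓘(ℂ) ω (bakerPoint hg₂ hg₃) := by
  intro z
  rw [contMDiffAt_iff_target]
  refine ⟨(continuous_bakerPoint hg₂ hg₃).continuousAt, ?_⟩
  exact (analyticAt_chart_bakerPoint hg₂ hg₃ (chart_mem_atlas ℂ _)
    (mem_chart_source ℂ (bakerPoint hg₂ hg₃ z))).1.contDiffAt.contMDiffAt

/-- The bijection from the torus to the Fermat cubic. -/
def bakerEquiv (hg₂ : L.g₂ = 0) (hg₃ : L.g₃ = 1) : (ℂ ⧸ L.lattice) ≃ FermatCubic :=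
  Equiv.ofBijective (fun q => bakerPoint hg₂ hg₃ (Function.surjInv L.lattice.mkQ_surjective q)) <| by
    have hs := Function.surjInv_eq L.lattice.mkQ_surjective
    constructor
    · intro q q' h
      rw [← hs q, ← hs q']
      exact (Submodule.Quotient.eq _).2 ((bakerPoint_eq_iff hg₂ hg₃).1 h)
    · intro p
      obtain ⟨z, rfl⟩ := bakerPoint_surjective hg₂ hg₃ p
      exact ⟨L.lattice.mkQ z, (bakerPoint_eq_iff hg₂ hg₃).2
        ((Submodule.Quotient.eq _).1 (hs (L.lattice.mkQ z)))⟩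

theorem bakerEquiv_mkQ (hg₂ : L.g₂ = 0) (hg₃ : L.g₃ = 1) (z : ℂ) :
    bakerEquiv hg₂ hg₃ (L.lattice.mkQ z) = bakerPoint hg₂ hg₃ z :=
  (bakerPoint_eq_iff hg₂ hg₃).2 ((Submodule.Quotient.eq _).1
    (Function.surjInv_eq L.lattice.mkQ_surjective (L.lattice.mkQ z)))

/-- Charts of the torus are local sections of the projection, so locally the map is `bakerPoint`
after a chart. -/
theorem contMDiff_bakerEquiv (hg₂ : L.g₂ = 0) (hg₃ : L.g₃ = 1) :
    ContMDiff 𝓘(ℂ) 𝓘(ℂ) ω (bakerEquiv hg₂ hg₃) := by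
  intro q
  have he : ContMDiffAt 𝓘(ℂ) 𝓘(ℂ) ω (chartAt ℂ q) q :=
    contMDiffOn_chart.contMDiffAt (chart_source_mem_nhds ℂ q)
  refine ((contMDiff_bakerPoint hg₂ hg₃ (chartAt ℂ q q)).comp q he).congr_of_eventuallyEq ?_
  filter_upwards [chart_source_mem_nhds ℂ q] with q' hq'
  rw [Function.comp_apply, ← bakerEquiv_mkQ,
    ComplexTorus.mkQ_apply_of_mem_atlas (chart_mem_atlas ℂ q) hq']

/-- The inverse function theorem supplies a holomorphic h with g ∘ h = id in charts. Injectivity of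
the chart `e'` then identifies `e.symm` ∘ h ∘ `e'` with the inverse near p, without assuming the
inverse continuous. -/
theorem contMDiff_bakerEquiv_symm (hg₂ : L.g₂ = 0) (hg₃ : L.g₃ = 1) :
    ContMDiff 𝓘(ℂ) 𝓘(ℂ) ω (bakerEquiv hg₂ hg₃).symm := by
  intro p
  set q := (bakerEquiv hg₂ hg₃).symm p with hq
  set e := chartAt ℂ q
  set z₀ := e q
  have hz₀ : z₀ ∈ e.target := mem_chart_target ℂ q
  have hp : bakerPoint hg₂ hg₃ z₀ = p := by
    rw [← bakerEquiv_mkQ, ComplexTorus.mkQ_apply_of_mem_atlas (chart_mem_atlas ℂ q)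
      (mem_chart_source ℂ q), hq, Equiv.apply_symm_apply]
  set e' := chartAt ℂ p
  have hsource : bakerPoint hg₂ hg₃ z₀ ∈ e'.source := hp ▸ mem_chart_source ℂ p
  obtain ⟨hg, hg'⟩ := analyticAt_chart_bakerPoint hg₂ hg₃ (chart_mem_atlas ℂ p) hsource
  set g := e' ∘ bakerPoint hg₂ hg₃
  have hgz : g z₀ = e' p := congrArg e' hp
  have hgc : ContDiffAt ℂ ω g z₀ := hg.contDiffAt
  have hgd := hg.differentiableAt.hasDerivAt.hasFDerivAt_equiv hg'
  set h := hgc.localInverse hgd (by simp)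
  have hc : ContDiffAt ℂ ω h (e' p) := hgz ▸ hgc.to_localInverse hgd (by simp)
  have hh0 : h (e' p) = z₀ := hgz ▸ hgc.localInverse_apply_image hgd (by simp)
  have hright : ∀ᶠ t in 𝓝 (e' p), g (h t) = t :=
    hgz ▸ (hgc.hasStrictFDerivAt' hgd (by simp)).eventually_right_inverse
  have hce' : ContMDiffAt 𝓘(ℂ) 𝓘(ℂ) ω e' p :=
    contMDiffOn_chart.contMDiffAt (chart_source_mem_nhds ℂ p)
  have hce : ContMDiffAt 𝓘(ℂ) 𝓘(ℂ) ω e.symm (h (e' p)) := by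
    rw [hh0]
    exact contMDiffOn_chart_symm.contMDiffAt (e.open_target.mem_nhds hz₀)
  have hhe' : ContMDiffAt 𝓘(ℂ) 𝓘(ℂ) ω (fun p' => h (e' p')) p := hc.contMDiffAt.comp p hce'
  refine (hce.comp p hhe').congr_of_eventuallyEq ?_
  have hT : Tendsto (fun p' => h (e' p')) (𝓝 p) (𝓝 z₀) := hh0 ▸ hhe'.continuousAt
  filter_upwards [chart_source_mem_nhds ℂ p, hce'.continuousAt.eventually hright,
    hT.eventually (e.open_target.mem_nhds hz₀),
    hT.eventually ((continuous_bakerPoint hg₂ hg₃).continuousAt.eventually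
      (e'.open_source.mem_nhds hsource))] with p' h1 h2 h3 h4
  have h5 : bakerPoint hg₂ hg₃ (h (e' p')) = p' := e'.injOn h4 h1 h2
  rw [Equiv.symm_apply_eq, Function.comp_apply,
    ComplexTorus.symm_apply_of_mem_atlas (chart_mem_atlas ℂ q) h3, bakerEquiv_mkQ, h5]

/-- The biholomorphism from the torus to the Fermat cubic. -/
def bakerDiffeomorph (hg₂ : L.g₂ = 0) (hg₃ : L.g₃ = 1) :
    (ℂ ⧸ L.lattice) ≃ₘ^ω⟮𝓘(ℂ), 𝓘(ℂ)⟯ FermatCubic where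
  toEquiv := bakerEquiv hg₂ hg₃
  contMDiff_toFun := contMDiff_bakerEquiv hg₂ hg₃
  contMDiff_invFun := contMDiff_bakerEquiv_symm hg₂ hg₃

end BakerPoint

end

theorem mainTheorem1 (L : PeriodPair) (hg₂ : L.g₂ = 0) (hg₃ : L.g₃ = 1) :
    (∃ Φ : (ℂ ⧸ L.lattice) ≃ₘ^ω⟮𝓘(ℂ), 𝓘(ℂ)⟯ FermatCubic,
      ∀ z : ℂ, z ∉ L.lattice → L.weierstrassP z ≠ 0 →
        (Φ (L.lattice.mkQ z)).toCP2 = CP2.affine (bakerF L z) (bakerG L z)) ∧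
    ∀ F G : ℂ → ℂ, Meromorphic F → Meromorphic G →
      (fun z => F z ^ 3 + G z ^ 3) =ᶠ[Filter.codiscrete ℂ] (fun _ => 1) →
      ∃ α : ℂ → ℂ, Differentiable ℂ α ∧
        F =ᶠ[Filter.codiscrete ℂ] (fun z => bakerF L (α z)) ∧
        G =ᶠ[Filter.codiscrete ℂ] (fun z => bakerG L (α z)) := by
  exact ⟨⟨bakerDiffeomorph hg₂ hg₃, fun z hz h0 =>
    (congrArg FermatCubic.toCP2 (bakerEquiv_mkQ hg₂ hg₃ z)).trans
      (toCP2_bakerPoint_eq_affine hg₂ hg₃ hz h0)⟩,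
    fun _ _ hF hG h => exists_entire_of_cube_add_cube_eq_one hg₂ hg₃ hF hG h⟩
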